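/- Let $k$ be an algebraically closed field, let $K$ be a finite dimensional Hopf algebra over $k$, and let $A$ be a right $K$-comodule algebra, that is, a unital associative $k$-algebra with an algebra homomorphism $\rho\colon A\to A\otimes_k K$ which makes $A$ a right $K$-comodule. Put $A^K=\{a\in A:\rho(a)=a\otimes 1\}$. Let $Z\subseteq A$ be a central $k$-subalgebra (not necessarily $K$-costable) which is an integral domain, with field of fractions $Q$. Assume that 1. $A$ is finitely generated as a $Z$-module; 2. $Q\otimes_Z A$ is a central simple algebra with center $Q$; and that at least one of the following two conditions holds: * (i) $A$ is a torsion-free $Z$-module and $Z$ is integrally closed in $Q$; * (ii) $A$ is a projective $Z$-module. Let $Q^K\subseteq Q$ be the field of fractions of $Z\cap A^K$. Then the degree $[Q:Q^K]$ is finite and divides $\dim_k K$. -/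

import Mathlib

open scoped TensorProduct

/-- An algebra homomorphism `ρ : A → A ⊗ K` is a right coaction of the bialgebra `K`, making the
algebra `A` a right `K`-comodule algebra:
`(ρ ⊗ id) ∘ ρ = (id ⊗ Δ) ∘ ρ` and `(id ⊗ ε) ∘ ρ = id`, where
`(A ⊗ K) ⊗ K` is identified with `A ⊗ (K ⊗ K)`, and `A ⊗ k` with `A`. -/
structure IsRightCoaction {k A K : Type*} [Field k] [Ring A] [Algebra k A] [Ring K]
    [Bialgebra k K] (ρ : A →ₐ[k] A ⊗[k] K) : Prop where
  coassoc : ∀ a : A, TensorProduct.assoc k A K K (ρ.toLinearMap.rTensor K (ρ a)) =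
    (Coalgebra.comul (R := k) (A := K)).lTensor A (ρ a)
  counit : ∀ a : A, TensorProduct.rid k A
    ((Coalgebra.counit (R := k) (A := K)).lTensor A (ρ a)) = a

/-- The subalgebra `A ^ K` of invariants of `ρ`: all `a` with `ρ a = a ⊗ 1`. -/
def coactionInvariants {k A K : Type*} [Field k] [Ring A] [Algebra k A] [Ring K]
    [Bialgebra k K] (ρ : A →ₐ[k] A ⊗[k] K) : Subalgebra k A :=
  AlgHom.equalizer ρ Algebra.TensorProduct.includeLeft

/-- The subalgebra `Z ∩ A ^ K` of `Z`, where `Z` is a commutative algebra mapping to the center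
of `A`: all `z` in `Z` whose image in `A` is invariant. -/
def invariantsIn (Z : Type*) {k A K : Type*} [Field k] [Ring A] [Algebra k A] [Ring K]
    [Bialgebra k K] [CommRing Z] [Algebra k Z] [Algebra Z A] [IsScalarTower k Z A]
    (ρ : A →ₐ[k] A ⊗[k] K) : Subalgebra k Z :=
  (coactionInvariants ρ).comap (IsScalarTower.toAlgHom k Z A)

/-!
Inverting the nonzero elements of `Z` turns `A` into the central simple `Q`-algebra `B = Q ⊗ A`.
Since `z ⊗ 1` is regular in `A ⊗ K` for `z ≠ 0`, so is `ρ z`, because the antipode makes left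
multiplication by `ρ z` conjugate to left multiplication by `z ⊗ 1`. Hence `ρ z` becomes invertible
in the finite-dimensional `Q`-algebra `E = B ⊗ K`, and `ρ` extends to a coaction on `B`
(`isUnit_map_coaction`, `exists_extension_of_isUnit`, `ExtendsCoaction.isRightCoaction`).

*Central simple algebras.* Let `ρ` be a coaction on `B`, and let `F ⊆ Q` be the field of those
central elements that are invariant. The algebra `Q ⊗[F] B`, with the coaction `id ⊗ ρ`, maps to `E`
by `q ⊗ b ↦ (q ⊗ 1) ρ(b)`.
* A tensor of minimal length in a nonzero subspace stable under multiplication by `B` and under the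
  operators given by functionals on `K` has the form `w ⊗ 1` (`exists_tmul_one_mem`). So for every
  nonzero representation `π` of `Q ⊗[F] B` the map `(π ⊗ id) ∘ (id ⊗ ρ)` is injective
  (`map_comp_extendCoaction_injective`). Taking for `π` the multiplication map shows that
  `Q ⊗[F] B → E` is injective and that `B` is finite over `F`.
* Some power `E ^ t` with `t > 0` is a free right module over `Q ⊗[F] B` (`exists_free_power`).
  Choose a simple right module `S` whose multiplicity in the top of `E`, relative to that in the
  top of the ring, is as large as possible. A power of `E` then has so few generators that
  evaluating right linear maps into `A' = End(S)ᵒᵖ` at these generators is bijective, by dimension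
  count (`exists_rightGenerates`). Twisting maps into `A'` by elements of `K` gives `dim K` times
  as many maps into `A' ⊗ K`, so that evaluation is bijective for `A' ⊗ K` too. A relation among
  the generators therefore vanishes in `A' ⊗ K`, hence in `Q ⊗[F] B`, which embeds there
  (`rightGenerates_independent`).
* If `E ^ t` is free of rank `s`, then `t · dim Hom(E, B) = s · dim B`, where `Hom` denotes right
  linear maps. As `Hom(E, B)` is a bimodule over the central simple algebra `B`, its dimension is a
  multiple `c · dim B`, and `s = t c`. Comparing `dim_Q E ^ t = t · dim B · dim K` with
  `s · dim_F B = t c [Q : F] dim B` gives `dim K = c [Q : F]` (`finrank_dvd_of_coaction`).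

*The field of invariants.* It remains to see that `F` is the field of fractions of `Z ∩ A^K`. Let
`z ∈ Z` be nonzero and let `χ` be the characteristic polynomial of right multiplication by `ρ z`
on `E`. Under either of the two hypotheses `χ` has coefficients in `Z`
(`exists_map_eq_charpoly_mulRight_of_isIntegrallyClosed`,
`exists_map_eq_charpoly_mulRight_of_projective`). The counit sends `z ⊗ 1 - ρ z` to `0`, so this
element is not invertible and `χ(z) = 0`; hence `z` divides `χ(0)`, which is the determinant up to
sign. Computing the determinant on the free module `E ^ t` shows that its `t`-th power lies in `F`
(`exists_det_pow_eq_algebraMap`). So every nonzero element of `Z` has a nonzero invariant multiple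
(`exists_dvd_mem_invariantField`), and every element of `F` can be written with an invariant
denominator (`exists_div_of_mem_invariantField`).
-/

open scoped TensorProduct

universe u

/-! ### Homomorphisms between finite-dimensional modules -/

section ModuleTheory

variable {Q R : Type*} [Field Q] [Ring R] [Algebra Q R]

instance finite_hom_of_finite (X Y : Type*) [AddCommGroup X] [Module Q X] [Module R X]
    [IsScalarTower Q R X] [AddCommGroup Y] [Module Q Y] [Module R Y] [IsScalarTower Q R Y]
    [Module.Finite Q X] [Module.Finite Q Y] : Module.Finite Q (X →ₗ[R] Y) :=
  Module.Finite.of_injective (LinearMap.restrictScalarsₗ Q R X Y Q)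
    (LinearMap.restrictScalars_injective Q)

theorem finrank_hom_of_isCompl {X Y : Type*} [AddCommGroup X] [Module Q X] [Module R X]
    [IsScalarTower Q R X] [AddCommGroup Y] [Module Q Y] [Module R Y] [IsScalarTower Q R Y]
    [Module.Finite Q X] [Module.Finite Q Y] {S T : Submodule R X} (h : IsCompl S T) :
    Module.finrank Q (X →ₗ[R] Y) =
      Module.finrank Q (S →ₗ[R] Y) + Module.finrank Q (T →ₗ[R] Y) := by
  have hS : Module.Finite Q S := Module.Finite.of_injective (S.subtype.restrictScalars Q)
    S.subtype_injective
  have hT : Module.Finite Q T := Module.Finite.of_injective (T.subtype.restrictScalars Q)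
    T.subtype_injective
  rw [← Module.finrank_prod]
  exact ((LinearMap.coprodEquiv (R := R) Q).trans
    (LinearEquiv.congrLeft Y Q (Submodule.prodEquivOfIsCompl S T h))).finrank_eq.symm

/-- A semisimple module is a quotient of another one in which every simple module occurs at least as
often. Multiplicities are measured by dimensions of spaces of maps to `R ⧸ I`. -/
theorem exists_surjective_of_finrank_hom_le_of_isSemisimpleModule [Module.Finite Q R]
    {X Y : Type*} [AddCommGroup X]
    [Module Q X] [Module R X] [IsScalarTower Q R X] [AddCommGroup Y] [Module Q Y] [Module R Y]
    [IsScalarTower Q R Y] [Module.Finite Q X] [Module.Finite Q Y]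
    [IsSemisimpleModule R X] [IsSemisimpleModule R Y]
    (h : ∀ I : Ideal R, I.IsMaximal →
      Module.finrank Q (X →ₗ[R] R ⧸ I) ≤ Module.finrank Q (Y →ₗ[R] R ⧸ I)) :
    ∃ f : Y →ₗ[R] X, Function.Surjective f := by
  induction hn : Module.finrank Q X using Nat.strong_induction_on generalizing X Y with
  | _ n ih =>
  subst hn
  rcases subsingleton_or_nontrivial X with hX | hX
  · exact ⟨0, fun x => ⟨0, Subsingleton.elim _ _⟩⟩
  obtain ⟨S, hS⟩ := IsSemisimpleModule.exists_simple_submodule R X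
  obtain ⟨X', hX'⟩ := exists_isCompl S
  obtain ⟨I, hI, ⟨e⟩⟩ := isSimpleModule_iff_quot_maximal.1 hS
  have hRI : IsSimpleModule R (R ⧸ I) := isSimpleModule_iff_quot_maximal.2 ⟨I, hI, ⟨.refl _ _⟩⟩
  -- a nonzero map from `Y` onto the simple module
  have hpos : 0 < Module.finrank Q (X →ₗ[R] R ⧸ I) := by
    rw [Module.finrank_pos_iff_exists_ne_zero]
    refine ⟨e.toLinearMap ∘ₗ Submodule.projectionOnto S X' hX', fun h0 => ?_⟩
    have : Nontrivial S := IsSimpleModule.nontrivial R S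
    obtain ⟨s, hs⟩ := exists_ne (0 : S)
    have := LinearMap.congr_fun h0 (s : X)
    simp at this
    exact hs (by simpa using this)
  obtain ⟨g, hg⟩ := Module.finrank_pos_iff_exists_ne_zero.1 (hpos.trans_le (h I hI))
  have hgs : Function.Surjective g := LinearMap.surjective_of_ne_zero hg
  obtain ⟨T, hT⟩ := exists_isCompl (LinearMap.ker g)
  have eT : T ≃ₗ[R] R ⧸ I :=
    (Submodule.quotientEquivOfIsCompl _ _ hT).symm.trans (g.quotKerEquivOfSurjective hgs)
  have fX' : Module.Finite Q X' := Module.Finite.of_injective (X'.subtype.restrictScalars Q)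
    X'.subtype_injective
  have fS : Module.Finite Q S := Module.Finite.of_injective (S.subtype.restrictScalars Q)
    S.subtype_injective
  have fY' : Module.Finite Q (LinearMap.ker g) := Module.Finite.of_injective
    ((LinearMap.ker g).subtype.restrictScalars Q) (LinearMap.ker g).subtype_injective
  have hlt : Module.finrank Q X' < Module.finrank Q X := by
    have h1 := ((Submodule.prodEquivOfIsCompl S X' hX').restrictScalars Q).finrank_eq
    rw [Module.finrank_prod] at h1
    have : Nontrivial S := IsSimpleModule.nontrivial R S
    have h2 : 0 < Module.finrank Q S := Module.finrank_pos
    omega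
  obtain ⟨f, hf⟩ := ih _ hlt (X := X') (Y := LinearMap.ker g) (fun J hJ => by
    have h1 := h J hJ
    rw [finrank_hom_of_isCompl hX', finrank_hom_of_isCompl hT] at h1
    have h2 := (LinearEquiv.congrLeft (R ⧸ J) Q (e.trans eT.symm)).finrank_eq
    omega) rfl
  refine ⟨(Submodule.prodEquivOfIsCompl S X' hX').toLinearMap ∘ₗ
    (LinearMap.prodMap (eT.trans e.symm).toLinearMap f) ∘ₗ
    (Submodule.prodEquivOfIsCompl _ _ hT.symm).symm.toLinearMap, ?_⟩
  have h1 : Function.Surjective (LinearMap.prodMap (eT.trans e.symm).toLinearMap f) :=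
    (eT.trans e.symm).surjective.prodMap hf
  exact (Submodule.prodEquivOfIsCompl S X' hX').surjective.comp
    (h1.comp (Submodule.prodEquivOfIsCompl _ _ hT.symm).symm.surjective)

/-- Maps to a simple module factor through the top. -/
theorem finrank_hom_quotient_jacobson (X : Type*) [AddCommGroup X] [Module Q X] [Module R X]
    [IsScalarTower Q R X] (S : Type*) [AddCommGroup S] [Module Q S] [Module R S]
    [IsScalarTower Q R S] [IsSimpleModule R S] :
    Module.finrank Q ((X ⧸ Module.jacobson R X) →ₗ[R] S) = Module.finrank Q (X →ₗ[R] S) := by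
  refine LinearEquiv.finrank_eq (LinearEquiv.ofBijective
    ({ toFun := fun u => u ∘ₗ (Module.jacobson R X).mkQ
       map_add' := fun _ _ => rfl
       map_smul' := fun _ _ => rfl } : ((X ⧸ Module.jacobson R X) →ₗ[R] S) →ₗ[Q] (X →ₗ[R] S))
    ⟨fun u v h => ?_, fun u => ?_⟩)
  · exact Submodule.linearMap_qext _ h
  · have hS : Module.jacobson R S = ⊥ := IsSemisimpleModule.jacobson_eq_bot R S
    refine ⟨(Module.jacobson R X).liftQ u ?_, Submodule.liftQ_mkQ _ _ _⟩
    have := Module.le_comap_jacobson u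
    rwa [hS] at this

/-- Over a finite dimensional algebra, the number of times the simple modules occur in the tops
decides whether a projective module maps onto a given one. -/
theorem exists_surjective_of_finrank_hom_le [Module.Finite Q R]
    {X P : Type*} [AddCommGroup X]
    [Module Q X] [Module R X] [IsScalarTower Q R X] [AddCommGroup P] [Module Q P] [Module R P]
    [IsScalarTower Q R P] [Module.Finite Q X] [Module.Finite Q P] [Module.Projective R P]
    (h : ∀ I : Ideal R, I.IsMaximal →
      Module.finrank Q (X →ₗ[R] R ⧸ I) ≤ Module.finrank Q (P →ₗ[R] R ⧸ I)) :
    ∃ f : P →ₗ[R] X, Function.Surjective f := by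
  have hRA : IsArtinianRing R := isArtinian_of_tower Q inferInstance
  have fX : Module.Finite R X := Module.Finite.of_restrictScalars_finite Q R X
  have fP : Module.Finite R P := Module.Finite.of_restrictScalars_finite Q R P
  have sX : IsSemisimpleModule R (X ⧸ Module.jacobson R X) :=
    (IsArtinian.isSemisimpleModule_iff_jacobson R _).2 (Module.jacobson_quotient_jacobson R X)
  have sP : IsSemisimpleModule R (P ⧸ Module.jacobson R P) :=
    (IsArtinian.isSemisimpleModule_iff_jacobson R _).2 (Module.jacobson_quotient_jacobson R P)
  obtain ⟨g, hg⟩ := exists_surjective_of_finrank_hom_le_of_isSemisimpleModule (Q := Q) (R := R)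
    (X := X ⧸ Module.jacobson R X) (Y := P ⧸ Module.jacobson R P) (fun I hI => by
      have : IsSimpleModule R (R ⧸ I) := isSimpleModule_iff_quot_maximal.2 ⟨I, hI, ⟨.refl _ _⟩⟩
      rw [finrank_hom_quotient_jacobson, finrank_hom_quotient_jacobson]
      exact h I hI)
  obtain ⟨f, hf⟩ := Module.projective_lifting_property (Module.jacobson R X).mkQ
    (g ∘ₗ (Module.jacobson R P).mkQ) (Submodule.mkQ_surjective _)
  refine ⟨f, LinearMap.range_eq_top.1 ?_⟩
  -- a proper submodule would lie in a maximal one, which contains the Jacobson radical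
  by_contra hne
  obtain ⟨N, hN, hle⟩ := (eq_top_or_exists_le_coatom (LinearMap.range f)).resolve_left hne
  refine hN.1 (eq_top_iff.2 fun x _ => ?_)
  obtain ⟨y, hy⟩ := (hg.comp (Submodule.mkQ_surjective _)) ((Module.jacobson R X).mkQ x)
  have h1 : (Module.jacobson R X).mkQ (f y) = (Module.jacobson R X).mkQ x := by
    rw [← hy, ← LinearMap.comp_apply, hf]; rfl
  have h2 : f y - x ∈ Module.jacobson R X := by
    rw [← Submodule.Quotient.mk_eq_zero, ← Submodule.mkQ_apply, map_sub, h1, sub_self]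
  have h3 : f y - x ∈ N := (sInf_le (show N ∈ {m : Submodule R X | IsCoatom m} from hN)) h2
  have h4 : f y ∈ N := hle ⟨y, rfl⟩
  simpa using N.sub_mem h4 h3

/-- Fractions with bounded numerators and denominators attain their maximum. -/
theorem exists_maximal_ratio {ι : Type*} [Nonempty ι] (a b : ι → ℕ) (m n : ℕ)
    (ha : ∀ i, a i ≤ m) (hb : ∀ i, b i ≤ n) (hpos : ∀ i, 0 < b i) :
    ∃ i, ∀ j, b i * a j ≤ a i * b j := by
  have hfin : (Set.range fun i => (a i : ℚ) / b i).Finite := by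
    refine Set.Finite.subset (Set.Finite.image (fun p : ℕ × ℕ => (p.1 : ℚ) / (p.2 : ℚ))
      ((Set.finite_Iic m).prod (Set.finite_Iic n))) ?_
    rintro _ ⟨i, rfl⟩
    exact ⟨(a i, b i), ⟨ha i, hb i⟩, rfl⟩
  obtain ⟨_, ⟨i, rfl⟩, hmax⟩ := Set.exists_max_image _ id hfin (Set.range_nonempty _)
  refine ⟨i, fun j => ?_⟩
  have h1 := hmax _ ⟨j, rfl⟩
  simp only [id] at h1
  rw [div_le_div_iff₀ (by exact_mod_cast hpos j) (by exact_mod_cast hpos i)] at h1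
  rw [mul_comm]
  exact_mod_cast h1

theorem finrank_fin_fun (V : Type*) [AddCommGroup V] [Module Q V] [Module.Finite Q V] (n : ℕ) :
    Module.finrank Q (Fin n → V) = n * Module.finrank Q V := by
  rw [Module.finrank_pi_fintype]
  simp

theorem finrank_pi_hom (n : ℕ) (X S : Type*) [AddCommGroup X] [Module Q X] [Module R X]
    [IsScalarTower Q R X] [AddCommGroup S] [Module Q S] [Module R S] [IsScalarTower Q R S]
    [Module.Finite Q X] [Module.Finite Q S] :
    Module.finrank Q ((Fin n → X) →ₗ[R] S) = n * Module.finrank Q (X →ₗ[R] S) := by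
  rw [← (LinearMap.lsum R (fun _ : Fin n => X) Q (M := S)).finrank_eq, Module.finrank_pi_fintype]
  simp

theorem finrank_le_of_surjective_algebra_linear [Module.Finite Q R] (S : Type*) [AddCommGroup S]
    [Module Q S] [Module R S] [IsScalarTower Q R S] (f : R →ₗ[R] S) (hf : Function.Surjective f) :
    Module.finrank Q S ≤ Module.finrank Q R :=
  LinearMap.finrank_le_finrank_of_surjective (f := f.restrictScalars Q) hf

theorem finrank_hom_le (X S : Type*) [AddCommGroup X] [Module Q X] [Module R X]
    [IsScalarTower Q R X] [AddCommGroup S] [Module Q S] [Module R S] [IsScalarTower Q R S]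
    [Module.Finite Q X] [Module.Finite Q S] :
    Module.finrank Q (X →ₗ[R] S) ≤ Module.finrank Q X * Module.finrank Q S := by
  rw [← Module.finrank_linearMap Q Q]
  exact LinearMap.finrank_le_finrank_of_injective
    (f := LinearMap.restrictScalarsₗ Q R X S Q) (LinearMap.restrictScalars_injective Q)

/-- The surjection is as economical as possible: `S` is the simple module `R ⧸ I` for which
`dim Hom(X, S) / dim S` is largest, and `dim S = dim Hom(R, S)`. -/
theorem exists_surjective_pi {Q : Type*} {R : Type u} [Field Q] [Ring R] [Algebra Q R]
    [Module.Finite Q R] [Nontrivial R] (X : Type*) [AddCommGroup X] [Module Q X] [Module R X]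
    [IsScalarTower Q R X] [Module.Finite Q X] :
    ∃ (S : Type u) (_ : AddCommGroup S) (_ : Module Q S) (_ : Module R S)
      (_ : IsScalarTower Q R S) (_ : FiniteDimensional Q S) (_ : Nontrivial S)
      (f : (Fin (Module.finrank Q (X →ₗ[R] S)) → R) →ₗ[R] (Fin (Module.finrank Q S) → X)),
      Function.Surjective f := by
  have : Nonempty {I : Ideal R // I.IsMaximal} := by
    obtain ⟨I, hI⟩ := Ideal.exists_maximal R
    exact ⟨⟨I, hI⟩⟩
  have hquot : ∀ J : Ideal R, Module.finrank Q (R ⧸ J) ≤ Module.finrank Q R := fun J =>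
    finrank_le_of_surjective_algebra_linear (R ⧸ J) J.mkQ (Submodule.mkQ_surjective _)
  obtain ⟨⟨I, hI⟩, h⟩ := exists_maximal_ratio
    (fun I : {I : Ideal R // I.IsMaximal} => Module.finrank Q (X →ₗ[R] R ⧸ I.1))
    (fun I => Module.finrank Q (R ⧸ I.1)) (Module.finrank Q X * Module.finrank Q R)
    (Module.finrank Q R)
    (fun J => (finrank_hom_le X (R ⧸ J.1)).trans (Nat.mul_le_mul_left _ (hquot _)))
    (fun J => hquot _)
    (fun J => by
      have : Nontrivial (R ⧸ J.1) := Submodule.Quotient.nontrivial_iff.2 J.2.ne_top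
      exact Module.finrank_pos)
  refine ⟨R ⧸ I, inferInstance, inferInstance, inferInstance, inferInstance, inferInstance,
    Submodule.Quotient.nontrivial_iff.2 hI.ne_top,
    exists_surjective_of_finrank_hom_le (Q := Q) fun J hJ => ?_⟩
  rw [finrank_pi_hom, finrank_pi_hom, (LinearMap.ringLmapEquivSelf R Q (R ⧸ J)).finrank_eq]
  exact h ⟨J, hJ⟩

end ModuleTheory

/-! ### Right module maps and generation with bounded multiplicity -/

section RightHom

variable {Q A E P : Type*} [Field Q] [Ring A] [Algebra Q A] [Ring E] [Algebra Q E]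
  [Ring P] [Algebra Q P]

/-- Given algebra maps `j : A → E` and `p : A → P`, the `Q`-linear maps `E → P` that are linear for
the right `A`-module structures obtained from `j` and `p`. -/
def rightHom (j : A →ₐ[Q] E) (p : A →ₐ[Q] P) : Submodule Q (E →ₗ[Q] P) where
  carrier := {u | ∀ e a, u (e * j a) = u e * p a}
  add_mem' := fun hu hv e a => by simp [hu e a, hv e a, add_mul]
  zero_mem' := fun e a => by simp
  smul_mem' := fun c u hu e a => by simp [hu e a]

/-- `x` generates the right `A`-module `Fin t → E` (through `j`). -/
def RightGenerates {s t : ℕ} (j : A →ₐ[Q] E) (x : Fin s → Fin t → E) : Prop :=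
  ∀ y : Fin t → E, ∃ v : Fin s → A, ∀ l, y l = ∑ i, x i l * j (v i)

/-- Evaluation of tuples of right `A`-linear maps at a family of elements of `Fin t → E`. -/
def rightHomEval {s t : ℕ} (j : A →ₐ[Q] E) (p : A →ₐ[Q] P) (x : Fin s → Fin t → E) :
    (Fin t → rightHom j p) →ₗ[Q] (Fin s → P) where
  toFun U i := ∑ l, (U l).1 (x i l)
  map_add' U V := by ext i; simp [Finset.sum_add_distrib]
  map_smul' c U := by ext i; simp [Finset.smul_sum]

theorem sum_rightHomEval_mul {s t : ℕ} (j : A →ₐ[Q] E) (p : A →ₐ[Q] P) (x : Fin s → Fin t → E)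
    (U : Fin t → rightHom j p) (v : Fin s → A) :
    ∑ i, rightHomEval j p x U i * p (v i) = ∑ l, (U l).1 (∑ i, x i l * j (v i)) := by
  simp only [rightHomEval, LinearMap.coe_mk, AddHom.coe_mk, Finset.sum_mul, map_sum]
  rw [Finset.sum_comm]
  exact Finset.sum_congr rfl fun l _ => Finset.sum_congr rfl fun i _ => ((U l).2 _ _).symm

/-- Right linear maps on `E ^ t` are determined by their values on generators. -/
theorem rightHomEval_injective {s t : ℕ} {j : A →ₐ[Q] E} (p : A →ₐ[Q] P)
    {x : Fin s → Fin t → E} (hx : RightGenerates j x) :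
    Function.Injective (rightHomEval j p x) := by
  rw [injective_iff_map_eq_zero]
  intro U hU
  ext l e
  obtain ⟨v, hv⟩ := hx (Pi.single l e)
  have h := sum_rightHomEval_mul j p x U v
  simp only [hU, Pi.zero_apply, zero_mul, Finset.sum_const_zero, ← hv] at h
  rw [Finset.sum_eq_single l (fun l' _ hl' => by simp [hl']) (by simp)] at h
  simpa using h.symm

/-- The map `A ^ s → E ^ t` with matrix `x`. -/
def rightCombination {s t : ℕ} (j : A →ₐ[Q] E) (x : Fin s → Fin t → E) :
    (Fin s → A) →ₗ[Q] (Fin t → E) where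
  toFun v l := ∑ i, x i l * j (v i)
  map_add' v w := by ext l; simp [mul_add, Finset.sum_add_distrib]
  map_smul' c v := by ext l; simp [Finset.smul_sum]

theorem rightCombination_bijective {s t : ℕ} {j : A →ₐ[Q] E} {x : Fin s → Fin t → E}
    (hx : RightGenerates j x)
    (hinj : ∀ v : Fin s → A, (∀ l, ∑ i, x i l * j (v i) = 0) → v = 0) :
    Function.Bijective (rightCombination j x) := by
  refine ⟨(injective_iff_map_eq_zero _).2 fun v hv => hinj v fun l => congrFun hv l, fun y => ?_⟩
  obtain ⟨v, hv⟩ := hx y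
  exact ⟨v, funext fun l => (hv l).symm⟩

theorem rightCombination_mul {s t : ℕ} (j : A →ₐ[Q] E) (x : Fin s → Fin t → E) (v : Fin s → A)
    (a : A) :
    rightCombination j x (fun i => v i * a) = fun l => rightCombination j x v l * j a := by
  ext l
  simp [rightCombination, Finset.sum_mul, mul_assoc]

/-- A right linear map on a free module can be prescribed on a basis. -/
theorem rightHomEval_bijective {s t : ℕ} {j : A →ₐ[Q] E} (p : A →ₐ[Q] P)
    {x : Fin s → Fin t → E} (hx : RightGenerates j x)
    (hinj : ∀ v : Fin s → A, (∀ l, ∑ i, x i l * j (v i) = 0) → v = 0) :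
    Function.Bijective (rightHomEval j p x) := by
  refine ⟨rightHomEval_injective p hx, fun τ => ?_⟩
  set Φ := rightCombination j x with hΦdef
  have hΦ := rightCombination_bijective hx hinj
  let e := LinearEquiv.ofBijective Φ hΦ
  have he : ∀ v, e.symm (Φ v) = v := fun v => e.symm_apply_apply v
  let Ψ : (Fin s → A) →ₗ[Q] P :=
    { toFun := fun v => ∑ i, τ i * p (v i)
      map_add' := fun v w => by simp [mul_add, Finset.sum_add_distrib]
      map_smul' := fun c v => by simp [Finset.smul_sum] }
  have hΨa : ∀ v a, Ψ (fun i => v i * a) = Ψ v * p a := fun v a => by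
    simp [Ψ, Finset.sum_mul, mul_assoc]
  refine ⟨fun l => ⟨Ψ ∘ₗ e.symm.toLinearMap ∘ₗ LinearMap.single Q (fun _ => E) l,
    fun y a => ?_⟩, ?_⟩
  · obtain ⟨v, hv⟩ := hΦ.2 (Pi.single l y)
    have h2 : Pi.single l (y * j a) = Φ (fun i => v i * a) := by
      rw [hΦdef, rightCombination_mul, ← hΦdef, hv]
      ext l'
      by_cases h : l' = l
      · subst h; simp
      · simp [h]
    simp only [LinearMap.comp_apply, LinearMap.single_apply, LinearEquiv.coe_coe]
    rw [h2, ← hv, he, he, hΨa]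
  · ext i
    simp only [rightHomEval, LinearMap.coe_mk, AddHom.coe_mk, LinearMap.comp_apply,
      LinearEquiv.coe_coe]
    rw [← map_sum, ← map_sum]
    have h3 : ∑ l, LinearMap.single Q (fun _ => E) l (x i l) = Φ (Pi.single i 1) := by
      ext l
      simp only [LinearMap.coe_single, Finset.sum_apply, Finset.sum_pi_single, Finset.mem_univ,
        if_true, Φ, rightCombination, LinearMap.coe_mk, AddHom.coe_mk]
      rw [Finset.sum_eq_single i (fun i' _ hi' => by simp [hi']) (by simp)]
      simp
    rw [h3, he]
    simp only [Ψ, LinearMap.coe_mk, AddHom.coe_mk]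
    rw [Finset.sum_eq_single i (fun i' _ hi' => by simp [hi']) (by simp)]
    simp

theorem finrank_rightHom_of_free {s t : ℕ} {j : A →ₐ[Q] E} (p : A →ₐ[Q] P) [FiniteDimensional Q E]
    [FiniteDimensional Q P]
    {x : Fin s → Fin t → E} (hx : RightGenerates j x)
    (hinj : ∀ v : Fin s → A, (∀ l, ∑ i, x i l * j (v i) = 0) → v = 0) :
    t * Module.finrank Q (rightHom j p) = s * Module.finrank Q P := by
  have := (LinearEquiv.ofBijective _ (rightHomEval_bijective p hx hinj)).finrank_eq
  rw [finrank_fin_fun P] at this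
  exact (finrank_fin_fun (rightHom j p) t).symm.trans this

/-- If evaluation at the generators `x` is surjective for dimension reasons and `A` embeds in `P`,
then the generators are independent: extend each `Pi.single i 1` to a right linear map and apply it
to a relation. -/
theorem rightGenerates_independent_of_le {s t : ℕ} {j : A →ₐ[Q] E} {p : A →ₐ[Q] P}
    [FiniteDimensional Q E] [FiniteDimensional Q P] (hp : Function.Injective p)
    {x : Fin s → Fin t → E} (hx : RightGenerates j x)
    (hdim : s * Module.finrank Q P ≤ t * Module.finrank Q (rightHom j p))
    (v : Fin s → A) (hv : ∀ l, ∑ i, x i l * j (v i) = 0) : v = 0 := by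
  have hinj := rightHomEval_injective p hx
  have h1 := finrank_fin_fun (Q := Q) (rightHom j p) t
  have h2 := LinearMap.finrank_range_of_inj hinj
  have hsurj : Function.Surjective (rightHomEval j p x) := by
    refine LinearMap.range_eq_top.1 (Submodule.eq_top_of_finrank_eq
      (le_antisymm (Submodule.finrank_le _) ?_))
    rw [finrank_fin_fun, h2]
    exact hdim.trans h1.ge
  ext i
  obtain ⟨U, hU⟩ := hsurj (Pi.single i 1)
  have h := sum_rightHomEval_mul j p x U v
  simp only [hv, map_zero, Finset.sum_const_zero, hU] at h
  rw [Finset.sum_eq_single i (fun i' _ hi' => by simp [hi']) (by simp)] at h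
  refine hp ?_
  simpa using h

open MulOpposite

/-- The action of `A` on a right `A`-module `S`, as a map into the opposite of `End S`. -/
def rightAction (Q A S : Type*) [Field Q] [Ring A] [Algebra Q A] [AddCommGroup S] [Module Q S]
    [Module Aᵐᵒᵖ S] [IsScalarTower Q Aᵐᵒᵖ S] : A →ₐ[Q] (Module.End Q S)ᵐᵒᵖ :=
  (AlgHom.op (Algebra.lsmul Q Q S)).comp (AlgEquiv.opOp Q A).toAlgHom

/-- As a right `A`-module, the opposite of `End S` is a sum of `dim S` copies of `S`. -/
theorem finrank_rightHom_rightAction {S : Type*} [AddCommGroup S] [Module Q S] [Module Aᵐᵒᵖ S]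
    [IsScalarTower Q Aᵐᵒᵖ S] [FiniteDimensional Q S] [FiniteDimensional Q E]
    [Module Aᵐᵒᵖ E] [IsScalarTower Q Aᵐᵒᵖ E] (j : A →ₐ[Q] E)
    (hsmul : ∀ (a : A) (e : E), op a • e = e * j a) :
    Module.finrank Q (rightHom j (rightAction Q A S)) =
      Module.finrank Q S * Module.finrank Q (E →ₗ[Aᵐᵒᵖ] S) := by
  have hπ : ∀ a (σ : S), (rightAction Q A S a).unop σ = op a • σ := fun a σ => rfl
  let ev : rightHom j (rightAction Q A S) ≃ₗ[Q] (S →ₗ[Q] (E →ₗ[Aᵐᵒᵖ] S)) :=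
    { toFun := fun u =>
        { toFun := fun σ =>
            { toFun := fun e => (u.1 e).unop σ
              map_add' := fun e e' => by simp
              map_smul' := fun a e => by
                obtain ⟨a, rfl⟩ := op_surjective a
                rw [hsmul, u.2, unop_mul, Module.End.mul_apply, hπ]; rfl }
          map_add' := fun σ τ => by ext; simp
          map_smul' := fun c σ => by ext; simp }
      invFun := fun g => ⟨
        { toFun := fun e => op
            { toFun := fun σ => g σ e
              map_add' := fun σ τ => by simp
              map_smul' := fun c σ => by simp }
          map_add' := fun e e' => by
            refine unop_injective (LinearMap.ext fun σ => ?_); simp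
          map_smul' := fun c e => by
            refine unop_injective (LinearMap.ext fun σ => ?_)
            simp }, fun e a => by
            refine unop_injective (LinearMap.ext fun σ => ?_)
            rw [unop_mul, Module.End.mul_apply, hπ, ← hsmul]
            exact (g σ).map_smul (op a) e⟩
      map_add' := fun u v => by ext; simp
      map_smul' := fun c u => by ext; simp
      left_inv := fun u => rfl
      right_inv := fun g => rfl }
  rw [ev.finrank_eq, Module.finrank_linearMap]

/-- For a simple right module `S` maximizing the ratio of `dim Hom(E, S)` to `dim S`, there are
generators of a power of `E` for which evaluation of right linear maps into the opposite of
`End S` is an isomorphism for dimension reasons. -/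
theorem exists_rightGenerates {Q : Type*} {A : Type u} {E : Type*} [Field Q] [Ring A] [Algebra Q A]
    [Ring E] [Algebra Q E] [FiniteDimensional Q A] [Nontrivial A] [FiniteDimensional Q E]
    (j : A →ₐ[Q] E) :
    ∃ (S : Type u) (_ : AddCommGroup S) (_ : Module Q S) (_ : FiniteDimensional Q S)
      (_ : Nontrivial S) (π : A →ₐ[Q] (Module.End Q S)ᵐᵒᵖ) (s t : ℕ) (x : Fin s → Fin t → E),
      0 < t ∧ RightGenerates j x ∧
      t * Module.finrank Q (rightHom j π) = s * Module.finrank Q (Module.End Q S)ᵐᵒᵖ := by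
  let : Module Aᵐᵒᵖ E := Module.compHom E (AlgHom.op j).toRingHom
  have hsmul : ∀ (a : A) (e : E), op a • e = e * j a := fun a e => rfl
  have : IsScalarTower Q Aᵐᵒᵖ E := ⟨fun q a e => by
    obtain ⟨a, rfl⟩ := op_surjective a
    rw [← op_smul, hsmul, hsmul]; simp⟩
  obtain ⟨S, _, _, _, _, _, _, f, hf⟩ := exists_surjective_pi (Q := Q) (R := Aᵐᵒᵖ) E
  refine ⟨S, inferInstance, inferInstance, inferInstance, inferInstance, rightAction Q A S,
    Module.finrank Q (E →ₗ[Aᵐᵒᵖ] S), Module.finrank Q S,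
    fun i => f (Pi.single i 1), Module.finrank_pos, fun y => ?_, ?_⟩
  · obtain ⟨v, rfl⟩ := hf y
    refine ⟨fun i => (v i).unop, fun l => ?_⟩
    have h1 : v = ∑ i, v i • Pi.single i (1 : Aᵐᵒᵖ) := by
      ext l'
      simp [Finset.sum_apply, Pi.single_apply]
    conv_lhs => rw [h1, map_sum]
    rw [Finset.sum_apply]
    refine Finset.sum_congr rfl fun i _ => ?_
    rw [map_smul]
    rfl
  · have h2 : Module.finrank Q (Module.End Q S)ᵐᵒᵖ = Module.finrank Q S * Module.finrank Q S := by
      rw [(MulOpposite.opLinearEquiv Q).symm.finrank_eq, Module.finrank_linearMap]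
    rw [finrank_rightHom_rightAction j hsmul, h2]
    ring

end RightHom

/-! ### The antipode and coactions -/

section Antipode

variable {k A K : Type*} [Field k] [Ring A] [Algebra k A] [Ring K] [HopfAlgebra k K]

theorem lTensor_linearMap_counit (y : A ⊗[k] K) :
    (Algebra.linearMap k K ∘ₗ Coalgebra.counit (R := k) (A := K)).lTensor A y =
      (TensorProduct.rid k A ((Coalgebra.counit (R := k) (A := K)).lTensor A y)) ⊗ₜ 1 := by
  induction y with
  | zero => simp
  | add x y hx hy => rw [map_add, hx, hy, map_add, map_add, TensorProduct.add_tmul]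
  | tmul a c =>
    simp [Algebra.algebraMap_eq_smul_one, TensorProduct.smul_tmul]

/-- The map `x ⊗ c ↦ ρ x * (1 ⊗ S c)`. -/
noncomputable def mulAntipode (ρ : A →ₐ[k] A ⊗[k] K) : A ⊗[k] K →ₗ[k] A ⊗[k] K :=
  TensorProduct.lift ((LinearMap.mul k (A ⊗[k] K)).compl₁₂ ρ.toLinearMap
    ((Algebra.TensorProduct.includeRight (R := k) (A := A) (B := K)).toLinearMap ∘ₗ
      HopfAlgebra.antipode k))

@[simp]
theorem mulAntipode_tmul (ρ : A →ₐ[k] A ⊗[k] K) (x : A) (c : K) :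
    mulAntipode ρ (x ⊗ₜ c) = ρ x * (1 ⊗ₜ HopfAlgebra.antipode k c) := rfl

theorem mulAntipode_eq (ρ : A →ₐ[k] A ⊗[k] K) (y : A ⊗[k] K) :
    mulAntipode ρ y = (LinearMap.mul' k K ∘ₗ (HopfAlgebra.antipode k).lTensor K).lTensor A
      (TensorProduct.assoc k A K K (ρ.toLinearMap.rTensor K y)) := by
  induction y with
  | zero => simp
  | add x y hx hy => simp only [map_add, hx, hy]
  | tmul a c =>
    rw [mulAntipode_tmul, LinearMap.rTensor_tmul, AlgHom.toLinearMap_apply]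
    induction ρ a with
    | zero => simp
    | add x y hx hy => simp only [map_add, add_mul, TensorProduct.add_tmul, hx, hy]
    | tmul a' c' => simp

/-- The identity `a₀ ⊗ a₁ S(a₂) = a ⊗ 1` in a comodule. -/
theorem IsRightCoaction.mulAntipode_apply {ρ : A →ₐ[k] A ⊗[k] K} (hρ : IsRightCoaction ρ) (a : A) :
    mulAntipode ρ (ρ a) = a ⊗ₜ 1 := by
  rw [mulAntipode_eq, hρ.coassoc, ← LinearMap.lTensor_comp_apply, LinearMap.comp_assoc,
    HopfAlgebra.mul_antipode_lTensor_comul, lTensor_linearMap_counit, hρ.counit]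

/-- The map `x ⊗ c ↦ x₀ ⊗ S(x₁) c`. -/
noncomputable def antipodeMul (ρ : A →ₐ[k] A ⊗[k] K) : A ⊗[k] K →ₗ[k] A ⊗[k] K :=
  (LinearMap.mul' k K ∘ₗ (HopfAlgebra.antipode k).rTensor K).lTensor A ∘ₗ
    (TensorProduct.assoc k A K K).toLinearMap ∘ₗ ρ.toLinearMap.rTensor K

theorem IsRightCoaction.antipodeMul_apply {ρ : A →ₐ[k] A ⊗[k] K} (hρ : IsRightCoaction ρ) (a : A) :
    antipodeMul ρ (ρ a) = a ⊗ₜ 1 := by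
  simp only [antipodeMul, LinearMap.comp_apply, LinearEquiv.coe_coe]
  rw [hρ.coassoc, ← LinearMap.lTensor_comp_apply, LinearMap.comp_assoc,
    HopfAlgebra.mul_antipode_rTensor_comul, lTensor_linearMap_counit, hρ.counit]

theorem antipodeMul_mul (ρ : A →ₐ[k] A ⊗[k] K) (y : A ⊗[k] K) (c : K) :
    antipodeMul ρ (y * (1 ⊗ₜ c)) = antipodeMul ρ y * (1 ⊗ₜ c) := by
  induction y with
  | zero => simp
  | add x y hx hy => simp only [map_add, add_mul, hx, hy]
  | tmul a c' =>
    simp only [antipodeMul, LinearMap.comp_apply, LinearEquiv.coe_coe,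
      Algebra.TensorProduct.tmul_mul_tmul, mul_one, LinearMap.rTensor_tmul,
      AlgHom.toLinearMap_apply]
    induction ρ a with
    | zero => simp
    | add x y hx hy => simp only [map_add, add_mul, TensorProduct.add_tmul, hx, hy]
    | tmul a' c' => simp [mul_assoc]

/-- The map `a ⊗ h ↦ ρ a * (1 ⊗ h)`. -/
noncomputable def coactionMul (ρ : A →ₐ[k] A ⊗[k] K) : A ⊗[k] K →ₗ[k] A ⊗[k] K :=
  TensorProduct.lift ((LinearMap.mul k (A ⊗[k] K)).compl₁₂ ρ.toLinearMap
    (Algebra.TensorProduct.includeRight (R := k) (A := A) (B := K)).toLinearMap)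

@[simp]
theorem coactionMul_tmul (ρ : A →ₐ[k] A ⊗[k] K) (x : A) (c : K) :
    coactionMul ρ (x ⊗ₜ c) = ρ x * (1 ⊗ₜ c) := rfl

/-- The maps `coactionMul ρ` and `antipodeMul ρ` are mutually inverse. -/
theorem IsRightCoaction.antipodeMul_coactionMul {ρ : A →ₐ[k] A ⊗[k] K} (hρ : IsRightCoaction ρ)
    (y : A ⊗[k] K) : antipodeMul ρ (coactionMul ρ y) = y := by
  induction y with
  | zero => simp
  | add x y hx hy => simp only [map_add, hx, hy]
  | tmul a c => rw [coactionMul_tmul, antipodeMul_mul, hρ.antipodeMul_apply]; simp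

theorem IsRightCoaction.coactionMul_antipodeMul {ρ : A →ₐ[k] A ⊗[k] K} (hρ : IsRightCoaction ρ)
    (y : A ⊗[k] K) : coactionMul ρ (antipodeMul ρ y) = y := by
  induction y with
  | zero => simp
  | add x y hx hy => simp only [map_add, hx, hy]
  | tmul a c =>
    have h : ∀ z : A ⊗[k] K, coactionMul ρ ((LinearMap.mul' k K ∘ₗ
        (HopfAlgebra.antipode k).rTensor K).lTensor A (TensorProduct.assoc k A K K (z ⊗ₜ c))) =
        mulAntipode ρ z * (1 ⊗ₜ c) := fun z => by
      induction z with
      | zero => simp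
      | add x y hx hy => simp only [map_add, add_mul, TensorProduct.add_tmul, hx, hy]
      | tmul a' c' => simp [mul_assoc]
    have h2 := h (ρ a)
    rw [hρ.mulAntipode_apply] at h2
    simpa [antipodeMul] using h2

theorem coactionMul_mul (ρ : A →ₐ[k] A ⊗[k] K) (a : A) (y : A ⊗[k] K) :
    coactionMul ρ ((a ⊗ₜ 1) * y) = ρ a * coactionMul ρ y := by
  induction y with
  | zero => simp
  | add x y hx hy => simp only [map_add, mul_add, hx, hy]
  | tmul a' c => simp [mul_assoc]

/-- Left multiplication by `ρ z` on `A ⊗ K` is conjugate to left multiplication by `z ⊗ 1`. -/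
theorem IsRightCoaction.isLeftRegular_apply {ρ : A →ₐ[k] A ⊗[k] K} (hρ : IsRightCoaction ρ) {z : A}
    (hz : IsLeftRegular (z ⊗ₜ[k] (1 : K))) : IsLeftRegular (ρ z) := by
  intro x y h
  obtain ⟨x, rfl⟩ : ∃ x', coactionMul ρ x' = x := ⟨_, hρ.coactionMul_antipodeMul x⟩
  obtain ⟨y, rfl⟩ : ∃ y', coactionMul ρ y' = y := ⟨_, hρ.coactionMul_antipodeMul y⟩
  simp only [← coactionMul_mul] at h
  have h1 := congrArg (antipodeMul ρ) h
  rw [hρ.antipodeMul_coactionMul, hρ.antipodeMul_coactionMul] at h1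
  rw [hz h1]

end Antipode

instance finite_tensorProduct_left {k R V W : Type*} [Field k] [CommRing R] [Algebra k R]
    [AddCommGroup V] [Module k V] [Module R V] [IsScalarTower k R V] [AddCommGroup W] [Module k W]
    [Module.Finite R V] [Module.Finite k W] : Module.Finite R (V ⊗[k] W) :=
  Module.Finite.equiv (TensorProduct.AlgebraTensorModule.cancelBaseChange k R R V W)

section Freeness

variable {k Q K A E A' : Type*} [Field k] [Field Q] [Algebra k Q]
  [Ring K] [HopfAlgebra k K]
  [Ring A] [Algebra k A] [Algebra Q A] [IsScalarTower k Q A]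
  [Ring E] [Algebra k E] [Algebra Q E] [IsScalarTower k Q E]
  [Ring A'] [Algebra k A'] [Algebra Q A'] [IsScalarTower k Q A']

/-- The right `A`-linear map `e ↦ g(e₀) ⊗ h e₁` obtained from a right `A`-linear map `g`. -/
noncomputable def twistHom (δE : E →ₐ[Q] E ⊗[k] K) (h : K) :
    (E →ₗ[Q] A') →ₗ[Q] (E →ₗ[Q] A' ⊗[k] K) where
  toFun g := LinearMap.mulLeft Q (1 ⊗ₜ[k] h) ∘ₗ
    TensorProduct.AlgebraTensorModule.map g (LinearMap.id (R := k) (M := K)) ∘ₗ δE.toLinearMap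
  map_add' g g' := by
    ext e
    simp [TensorProduct.AlgebraTensorModule.map_add_left, mul_add]
  map_smul' c g := by
    ext e
    simp [TensorProduct.AlgebraTensorModule.map_smul_left]

theorem map_mul_of_mem_rightHom {j : A →ₐ[Q] E} {π : A →ₐ[Q] A'} {g : E →ₗ[Q] A'}
    (hg : g ∈ rightHom j π) (y : E ⊗[k] K) (a : A ⊗[k] K) :
    TensorProduct.AlgebraTensorModule.map g (LinearMap.id (R := k) (M := K))
        (y * Algebra.TensorProduct.map j (AlgHom.id k K) a) =
      TensorProduct.AlgebraTensorModule.map g (LinearMap.id (R := k) (M := K)) y *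
        Algebra.TensorProduct.map π (AlgHom.id k K) a := by
  induction y with
  | zero => simp
  | add x y hx hy => simp only [map_add, add_mul, hx, hy]
  | tmul e c =>
    induction a with
    | zero => simp
    | add x y hx hy => simp only [map_add, mul_add, hx, hy]
    | tmul a c' => simp [hg e a]

theorem twistHom_mem_rightHom {δA : A →ₐ[Q] A ⊗[k] K} {δE : E →ₐ[Q] E ⊗[k] K} {j : A →ₐ[Q] E}
    (hj : ∀ a, δE (j a) = Algebra.TensorProduct.map j (AlgHom.id k K) (δA a))
    {π : A →ₐ[Q] A'} {g : E →ₗ[Q] A'} (hg : g ∈ rightHom j π) (h : K) :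
    twistHom δE h g ∈
      rightHom j ((Algebra.TensorProduct.map π (AlgHom.id k K)).comp δA) := by
  intro e a
  simp only [twistHom, LinearMap.coe_mk, AddHom.coe_mk, LinearMap.comp_apply,
    AlgHom.toLinearMap_apply, LinearMap.mulLeft_apply, map_mul, hj, AlgHom.comp_apply]
  rw [map_mul_of_mem_rightHom hg, mul_assoc]

theorem map_mul_one_tmul (g : E →ₗ[Q] A') (y : E ⊗[k] K) (c : K) :
    TensorProduct.AlgebraTensorModule.map g (LinearMap.id (R := k) (M := K)) (y * (1 ⊗ₜ c)) =
      TensorProduct.AlgebraTensorModule.map g (LinearMap.id (R := k) (M := K)) y * (1 ⊗ₜ c) := by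
  induction y with
  | zero => simp
  | add x y hx hy => simp only [map_add, add_mul, hx, hy]
  | tmul e c => simp

/-- The maps `e ↦ g(e₀) ⊗ h e₁` determine the map `g` and the element `h`: applying the antipode
undoes the twist. -/
theorem eq_zero_of_sum_twistHom_eq_zero {δE : E →ₐ[Q] E ⊗[k] K}
    (hδE : IsRightCoaction (δE.restrictScalars k)) {ι : Type*} [Fintype ι] (b : Module.Basis ι k K)
    (g : ι → E →ₗ[Q] A') (h : ∑ i, twistHom δE (b i) (g i) = 0) : g = 0 := by
  classical
  have h1 : ∀ y : E ⊗[k] K, ∑ i, (1 ⊗ₜ[k] b i) *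
      TensorProduct.AlgebraTensorModule.map (g i) (LinearMap.id (R := k) (M := K))
        (mulAntipode (δE.restrictScalars k) y) = 0 := fun y => by
    induction y with
    | zero => simp
    | add x y hx hy => simp only [map_add, mul_add, Finset.sum_add_distrib, hx, hy, add_zero]
    | tmul e c =>
      have h2 := LinearMap.congr_fun h e
      simp only [twistHom, LinearMap.sum_apply, LinearMap.coe_mk, AddHom.coe_mk,
        LinearMap.comp_apply, AlgHom.toLinearMap_apply, LinearMap.mulLeft_apply,
        LinearMap.zero_apply] at h2
      simp only [mulAntipode_tmul, AlgHom.restrictScalars_apply, map_mul_one_tmul, ← mul_assoc]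
      rw [← Finset.sum_mul, h2, zero_mul]
  ext i e
  have h3 := h1 (δE e)
  have h4 := hδE.mulAntipode_apply e
  rw [AlgHom.restrictScalars_apply] at h4
  simp only [h4, TensorProduct.AlgebraTensorModule.map_tmul, LinearMap.id_apply,
    Algebra.TensorProduct.tmul_mul_tmul, one_mul, mul_one] at h3
  have h5 := congrArg (fun z => TensorProduct.equivFinsuppOfBasisRight b z i) h3
  simpa [Finsupp.finsetSum_apply, Finsupp.single_apply] using h5

/-- The maps `twistHom δE h g`, for `h` in a basis of `K`, are independent. -/
theorem finrank_rightHom_tensor_ge {δA : A →ₐ[Q] A ⊗[k] K} {δE : E →ₐ[Q] E ⊗[k] K} {j : A →ₐ[Q] E}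
    [FiniteDimensional k K] [FiniteDimensional Q E] [FiniteDimensional Q A']
    (hj : ∀ a, δE (j a) = Algebra.TensorProduct.map j (AlgHom.id k K) (δA a))
    (hδE : IsRightCoaction (δE.restrictScalars k)) (π : A →ₐ[Q] A') :
    Module.finrank k K * Module.finrank Q (rightHom j π) ≤
      Module.finrank Q
        (rightHom j ((Algebra.TensorProduct.map π (AlgHom.id k K)).comp δA)) := by
  let b := Module.finBasis k K
  let Θ : (Fin (Module.finrank k K) → rightHom j π) →ₗ[Q]
      rightHom j ((Algebra.TensorProduct.map π (AlgHom.id k K)).comp δA) :=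
    { toFun := fun g => ∑ i, ⟨twistHom δE (b i) (g i).1, twistHom_mem_rightHom hj (g i).2 _⟩
      map_add' := fun g g' => by
        rw [← Finset.sum_add_distrib]
        refine Finset.sum_congr rfl fun i _ => Subtype.ext ?_
        exact map_add (twistHom δE (b i)) _ _
      map_smul' := fun c g => by
        rw [Finset.smul_sum]
        refine Finset.sum_congr rfl fun i _ => Subtype.ext ?_
        exact map_smul (twistHom δE (b i)) _ _ }
  have hΘ : Function.Injective Θ := by
    rw [injective_iff_map_eq_zero]
    intro g hg
    have h1 := congrArg Subtype.val hg
    simp only [Θ, LinearMap.coe_mk, AddHom.coe_mk, AddSubmonoidClass.coe_finsetSum,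
      ZeroMemClass.coe_zero] at h1
    have h2 := eq_zero_of_sum_twistHom_eq_zero hδE b (fun i => (g i).1) h1
    ext i : 1
    exact Subtype.ext (congrFun h2 i)
  have := LinearMap.finrank_le_finrank_of_injective hΘ
  exact (finrank_fin_fun (rightHom j π) _).symm.trans_le this

/-- A Hopf module criterion for freeness: if evaluation of right linear maps into `A'` at the
generators `x` is an isomorphism for dimension reasons and `A → A' ⊗ K` is injective, then the
generators are independent. -/
theorem rightGenerates_independent {δA : A →ₐ[Q] A ⊗[k] K} {δE : E →ₐ[Q] E ⊗[k] K}
    {j : A →ₐ[Q] E} [FiniteDimensional k K] [FiniteDimensional Q E] [FiniteDimensional Q A']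
    (hj : ∀ a, δE (j a) = Algebra.TensorProduct.map j (AlgHom.id k K) (δA a))
    (hδE : IsRightCoaction (δE.restrictScalars k)) (π : A →ₐ[Q] A')
    (hπ : Function.Injective ((Algebra.TensorProduct.map π (AlgHom.id k K)).comp δA))
    {s t : ℕ} {x : Fin s → Fin t → E} (hx : RightGenerates j x)
    (hdim : t * Module.finrank Q (rightHom j π) = s * Module.finrank Q A')
    (v : Fin s → A) (hv : ∀ l, ∑ i, x i l * j (v i) = 0) : v = 0 := by
  refine rightGenerates_independent_of_le hπ hx ?_ v hv
  rw [Module.finrank_tensorProduct, ← mul_assoc, ← hdim, mul_assoc, mul_comm (Module.finrank Q _)]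
  exact Nat.mul_le_mul_left t (finrank_rightHom_tensor_ge hj hδE π)

end Freeness

/-! ### Tensors of minimal length -/

section MinimalLength

variable {F W B : Type*} [Field F] [AddCommGroup W] [Module F W] [Ring B] [Algebra F B]

theorem equivFinsuppOfBasisLeft_lTensor {ι : Type*} [DecidableEq ι] (ℬ : Module.Basis ι F W)
    (T : B →ₗ[F] B)
    (x : W ⊗[F] B) (i : ι) :
    TensorProduct.equivFinsuppOfBasisLeft ℬ (T.lTensor W x) i =
      T (TensorProduct.equivFinsuppOfBasisLeft ℬ x i) := by
  induction x with
  | zero => simp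
  | add x y hx hy => simp only [map_add, Finsupp.add_apply, hx, hy]
  | tmul w b => simp

/-- A minimal length argument. Let `B` be a simple ring and `𝒯` a set of operators on `B` killing
`1` whose common kernel meets the center of `B` in `F`. Then every nonzero subspace of `W ⊗ B` that
is stable under multiplication by `B` on both sides and under `𝒯` contains a nonzero `w ⊗ 1`. -/
theorem exists_tmul_one_mem [IsSimpleRing B] (𝒯 : Set (B →ₗ[F] B)) (h1 : ∀ T ∈ 𝒯, T 1 = 0)
    (hF : ∀ b : B, (∀ c, c * b = b * c) → (∀ T ∈ 𝒯, T b = 0) → ∃ f : F, algebraMap F B f = b)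
    (N : Submodule F (W ⊗[F] B))
    (hL : ∀ b, ∀ x ∈ N, (LinearMap.mulLeft F b).lTensor W x ∈ N)
    (hR : ∀ b, ∀ x ∈ N, (LinearMap.mulRight F b).lTensor W x ∈ N)
    (hT : ∀ T ∈ 𝒯, ∀ x ∈ N, T.lTensor W x ∈ N) (hN : N ≠ ⊥) :
    ∃ w : W, w ≠ 0 ∧ w ⊗ₜ[F] (1 : B) ∈ N := by
  classical
  let ℬ := Module.Basis.ofVectorSpace F W
  let φ := TensorProduct.equivFinsuppOfBasisLeft (N := B) ℬ
  have hφ : ∀ (T : B →ₗ[F] B) x i, φ (T.lTensor W x) i = T (φ x i) :=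
    equivFinsuppOfBasisLeft_lTensor ℬ
  obtain ⟨x₀, hx₀, hx₀0⟩ := Submodule.exists_mem_ne_zero_of_ne_bot hN
  obtain ⟨x, ⟨hxN, hx0⟩, hmin⟩ := (measure fun x : W ⊗[F] B => (φ x).support.card).wf.has_min
    {x | x ∈ N ∧ x ≠ 0} ⟨x₀, hx₀, hx₀0⟩
  have hφx : φ x ≠ 0 := by simpa using hx0
  obtain ⟨i₀, hi₀⟩ := Finsupp.support_nonempty_iff.2 hφx
  -- an element of `N` supported inside the support of `x` and missing `i₀` vanishes
  have hvan : ∀ y ∈ N, (∀ i, φ x i = 0 → φ y i = 0) → φ y i₀ = 0 → y = 0 := by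
    intro y hy hsub hyi
    by_contra hy0
    refine hmin y ⟨hy, hy0⟩ (Finset.card_lt_card ⟨fun i hi => ?_, fun hle => ?_⟩)
    · rw [Finsupp.mem_support_iff] at hi ⊢
      exact fun h => hi (hsub i h)
    · exact (Finsupp.mem_support_iff.1 (hle hi₀)) hyi
  -- the coefficients at `i₀` of such elements form a nonzero ideal, which contains `1`
  let J : TwoSidedIdeal B := TwoSidedIdeal.mk'
    {b | ∃ y ∈ N, (∀ i, φ x i = 0 → φ y i = 0) ∧ φ y i₀ = b}
    ⟨0, N.zero_mem, by simp⟩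
    (by
      rintro _ _ ⟨y, hy, hys, rfl⟩ ⟨z, hz, hzs, rfl⟩
      exact ⟨y + z, N.add_mem hy hz, fun i hi => by simp [hys i hi, hzs i hi], by simp⟩)
    (by
      rintro _ ⟨y, hy, hys, rfl⟩
      exact ⟨-y, N.neg_mem hy, fun i hi => by simp [hys i hi], by simp⟩)
    (by
      rintro b _ ⟨y, hy, hys, rfl⟩
      exact ⟨_, hL b y hy, fun i hi => by simp [hφ, hys i hi], by simp [hφ]⟩)
    (by
      rintro _ b ⟨y, hy, hys, rfl⟩
      exact ⟨_, hR b y hy, fun i hi => by simp [hφ, hys i hi], by simp [hφ]⟩)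
  have hJ : (1 : B) ∈ J := by
    refine IsSimpleRing.one_mem_of_ne_zero_mem J (Finsupp.mem_support_iff.1 hi₀) ?_
    rw [TwoSidedIdeal.mem_mk']
    exact ⟨x, hxN, fun _ h => h, rfl⟩
  rw [TwoSidedIdeal.mem_mk'] at hJ
  obtain ⟨y, hyN, hys, hy1⟩ := hJ
  -- hence `T y = 0` whenever `T` preserves `N` and kills `1`
  have hkill : ∀ T : B →ₗ[F] B, (∀ z ∈ N, T.lTensor W z ∈ N) → T 1 = 0 → ∀ i, T (φ y i) = 0 := by
    intro T hTN hT1 i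
    rw [← hφ, hvan _ (hTN y hyN) (fun i hi => by rw [hφ, hys i hi, map_zero])
      (by rw [hφ, hy1, hT1])]
    simp
  have hcoef : ∀ i, ∃ f : F, algebraMap F B f = φ y i := fun i => by
    refine hF _ (fun c => ?_) fun T hT' => hkill T (hT T hT') (h1 T hT') i
    have := hkill (LinearMap.mulLeft F c - LinearMap.mulRight F c) (fun z hz => by
      rw [LinearMap.lTensor_sub, LinearMap.sub_apply]
      exact N.sub_mem (hL c z hz) (hR c z hz)) (by simp) i
    simpa [sub_eq_zero] using this
  choose f hf using hcoef
  have hyeq : y = (∑ i ∈ (φ y).support, f i • ℬ i) ⊗ₜ[F] (1 : B) := by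
    rw [TensorProduct.sum_tmul]
    calc y = φ.symm (φ y) := (φ.symm_apply_apply y).symm
      _ = _ := by
        simp only [φ, TensorProduct.equivFinsuppOfBasisLeft_symm_apply, Finsupp.sum]
        refine Finset.sum_congr rfl fun i _ => ?_
        rw [TensorProduct.smul_tmul, ← Algebra.algebraMap_eq_smul_one, hf]
  refine ⟨_, fun h0 => ?_, hyeq ▸ hyN⟩
  rw [h0, TensorProduct.zero_tmul] at hyeq
  rw [hyeq] at hy1
  simp at hy1

end MinimalLength

section Operators

variable {k B K : Type*} [Field k] [Ring B] [Algebra k B] [Ring K] [HopfAlgebra k K]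

/-- The operator `b ↦ f(b₁) b₀` on a comodule algebra given by a functional `f`. -/
noncomputable def coactionOp (ρ : B →ₐ[k] B ⊗[k] K) (f : K →ₗ[k] k) : B →ₗ[k] B :=
  (TensorProduct.rid k B).toLinearMap ∘ₗ f.lTensor B ∘ₗ ρ.toLinearMap

theorem coactionOp_apply (ρ : B →ₐ[k] B ⊗[k] K) (f : K →ₗ[k] k) (b : B) :
    coactionOp ρ f b = TensorProduct.rid k B (f.lTensor B (ρ b)) := rfl

theorem rid_lTensor_mul (f : K →ₗ[k] k) (x : B) (y : B ⊗[k] K) :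
    TensorProduct.rid k B (f.lTensor B ((x ⊗ₜ 1) * y)) =
      x * TensorProduct.rid k B (f.lTensor B y) := by
  induction y with
  | zero => simp
  | add y z hy hz => simp only [mul_add, map_add, hy, hz]
  | tmul b c => simp

theorem IsRightCoaction.apply_coactionOp {ρ : B →ₐ[k] B ⊗[k] K} (hρ : IsRightCoaction ρ)
    (f : K →ₗ[k] k) (b : B) :
    ρ (coactionOp ρ f b) = ((TensorProduct.rid k K).toLinearMap ∘ₗ f.lTensor K ∘ₗ
      Coalgebra.comul (R := k) (A := K)).lTensor B (ρ b) := by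
  have h : ∀ y : B ⊗[k] K, ρ (TensorProduct.rid k B (f.lTensor B y)) =
      ((TensorProduct.rid k K).toLinearMap ∘ₗ f.lTensor K).lTensor B
        (TensorProduct.assoc k B K K (ρ.toLinearMap.rTensor K y)) := fun y => by
    induction y with
    | zero => simp
    | add y z hy hz => simp only [map_add, hy, hz]
    | tmul x c =>
      simp only [LinearMap.lTensor_tmul, TensorProduct.rid_tmul, map_smul, LinearMap.rTensor_tmul,
        AlgHom.toLinearMap_apply]
      induction ρ x with
      | zero => simp
      | add y z hy hz => simp only [map_add, smul_add, TensorProduct.add_tmul, hy, hz]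
      | tmul x' c' => simp
  rw [coactionOp_apply, h, hρ.coassoc, ← LinearMap.lTensor_comp_apply, LinearMap.comp_assoc]

theorem eq_tmul_one_of_forall_functional (b : B) (y : B ⊗[k] K)
    (h : ∀ f : K →ₗ[k] k, TensorProduct.rid k B (f.lTensor B y) = f 1 • b) : y = b ⊗ₜ 1 := by
  classical
  let c := Module.Basis.ofVectorSpace k K
  refine (TensorProduct.equivFinsuppOfBasisRight (M := B) c).injective (Finsupp.ext fun i => ?_)
  rw [TensorProduct.equivFinsuppOfBasisRight_apply, h]
  simp

theorem hopfAlgebra_nontrivial (k K : Type*) [Field k] [Ring K] [HopfAlgebra k K] : Nontrivial K :=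
  (Bialgebra.counitAlgHom k K).toRingHom.domain_nontrivial

end Operators

/-! ### Coactions over a field of invariants -/

section Generic

variable {k F Q B K : Type*} [Field k] [Field F] [Field Q] [Algebra k F] [Algebra k Q] [Algebra F Q]
  [IsScalarTower k F Q] [Ring K] [HopfAlgebra k K]
  [Ring B] [Algebra k B] [Algebra F B] [Algebra Q B] [IsScalarTower k F B] [IsScalarTower k Q B]
  [IsScalarTower F Q B]

/-- A coaction on `B` all of whose values on `F` are invariant, as an `F`-algebra map. -/
noncomputable def coactionOver (F : Type*) [Field F] [Algebra F B] [SMulCommClass k F B]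
    (ρ : B →ₐ[k] B ⊗[k] K)
    (hinv : ∀ f : F, ρ (algebraMap F B f) = algebraMap F B f ⊗ₜ 1) : B →ₐ[F] B ⊗[k] K where
  toRingHom := ρ.toRingHom
  commutes' := hinv

/-- The coaction `id ⊗ ρ` on `Q ⊗ B`, when `F` consists of invariants. -/
noncomputable def extendCoaction (Q : Type*) [Field Q] [Algebra k Q] [Algebra F Q]
    [IsScalarTower k F Q] (ρ : B →ₐ[k] B ⊗[k] K)
    (hinv : ∀ f : F, ρ (algebraMap F B f) = algebraMap F B f ⊗ₜ 1) :
    Q ⊗[F] B →ₐ[Q] (Q ⊗[F] B) ⊗[k] K :=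
  (Algebra.TensorProduct.assoc k F Q Q B K).symm.toAlgHom.comp
    (Algebra.TensorProduct.map (AlgHom.id Q Q) (coactionOver F ρ hinv))

omit [Algebra Q B] [IsScalarTower k Q B] [IsScalarTower F Q B] in
theorem extendCoaction_tmul (ρ : B →ₐ[k] B ⊗[k] K)
    (hinv : ∀ f : F, ρ (algebraMap F B f) = algebraMap F B f ⊗ₜ 1) (q : Q) (b : B) :
    extendCoaction Q ρ hinv (q ⊗ₜ b) =
      (TensorProduct.AlgebraTensorModule.assoc k F Q Q B K).symm (q ⊗ₜ ρ b) := rfl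

/-- Multiplication `Q ⊗ B → B`. -/
noncomputable def smulAlgHom (F Q B : Type*) [Field F] [Field Q] [Algebra F Q] [Ring B]
    [Algebra F B] [Algebra Q B] [IsScalarTower F Q B] : Q ⊗[F] B →ₐ[Q] B :=
  Algebra.TensorProduct.lift (Algebra.ofId Q B) (AlgHom.id F B)
    fun q b => Algebra.commutes q b

@[simp]
theorem smulAlgHom_tmul (q : Q) (b : B) : smulAlgHom F Q B (q ⊗ₜ b) = q • b := by
  rw [Algebra.smul_def]
  exact Algebra.TensorProduct.lift_tmul _ _ _ q b

/-- The `k`-linear map `b ↦ π (q ⊗ b)`. -/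
noncomputable def tmulHom {A' : Type*} [Ring A'] [Algebra k A'] [Algebra Q A']
    [IsScalarTower k Q A'] (π : Q ⊗[F] B →ₐ[Q] A') (q : Q) : B →ₗ[k] A' :=
  (π.toLinearMap.restrictScalars k) ∘ₗ ((TensorProduct.mk F Q B q).restrictScalars k)

omit [Algebra Q B] [IsScalarTower k Q B] [IsScalarTower F Q B] in
theorem map_assoc_symm {A' : Type*} [Ring A'] [Algebra k A'] [Algebra Q A'] [IsScalarTower k Q A']
    (π : Q ⊗[F] B →ₐ[Q] A') (q : Q) (y : B ⊗[k] K) :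
    Algebra.TensorProduct.map π (AlgHom.id k K)
      ((TensorProduct.AlgebraTensorModule.assoc k F Q Q B K).symm (q ⊗ₜ y)) =
      (tmulHom π q).rTensor K y := by
  induction y with
  | zero => simp
  | add y z hy hz => simp only [TensorProduct.tmul_add, map_add, hy, hz]
  | tmul b c => simp [tmulHom]

omit [Algebra k F] [IsScalarTower k F B] in
theorem coactionOp_smul {ρ : B →ₐ[k] B ⊗[k] K}
    (hinv : ∀ f : F, ρ (algebraMap F B f) = algebraMap F B f ⊗ₜ 1) (g : K →ₗ[k] k) (f : F) (b : B) :
    coactionOp ρ g (f • b) = f • coactionOp ρ g b := by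
  rw [coactionOp_apply, coactionOp_apply, Algebra.smul_def, map_mul, hinv, rid_lTensor_mul,
    Algebra.smul_def]

/-- The operator `coactionOp` as an `F`-linear map. -/
noncomputable def coactionOpOver {ρ : B →ₐ[k] B ⊗[k] K}
    (hinv : ∀ f : F, ρ (algebraMap F B f) = algebraMap F B f ⊗ₜ 1) (g : K →ₗ[k] k) : B →ₗ[F] B where
  toFun := coactionOp ρ g
  map_add' := map_add _
  map_smul' := coactionOp_smul hinv g

omit [Algebra Q B] [IsScalarTower k Q B] [IsScalarTower F Q B] in
/-- The kernel of `(π ⊗ id) ∘ (id ⊗ ρ)` is stable under the operators `coactionOp`, since these act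
on the right tensor factor after applying the coaction. -/
theorem map_extendCoaction_coactionOp {ρ : B →ₐ[k] B ⊗[k] K} (hρ : IsRightCoaction ρ)
    (hinv : ∀ f : F, ρ (algebraMap F B f) = algebraMap F B f ⊗ₜ 1)
    {A' : Type*} [Ring A'] [Algebra k A'] [Algebra Q A'] [IsScalarTower k Q A']
    (π : Q ⊗[F] B →ₐ[Q] A') (g : K →ₗ[k] k) (a : Q ⊗[F] B) :
    Algebra.TensorProduct.map π (AlgHom.id k K)
      (extendCoaction Q ρ hinv ((coactionOpOver hinv g).lTensor Q a)) =
    ((TensorProduct.rid k K).toLinearMap ∘ₗ g.lTensor K ∘ₗ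
      Coalgebra.comul (R := k) (A := K)).lTensor A'
      (Algebra.TensorProduct.map π (AlgHom.id k K) (extendCoaction Q ρ hinv a)) := by
  induction a with
  | zero => simp
  | add y z hy hz => simp only [map_add, hy, hz]
  | tmul q b =>
    have h : coactionOpOver hinv g b = coactionOp ρ g b := rfl
    rw [LinearMap.lTensor_tmul, extendCoaction_tmul, extendCoaction_tmul, map_assoc_symm,
      map_assoc_symm, h, hρ.apply_coactionOp, ← LinearMap.comp_apply, ← LinearMap.comp_apply,
      LinearMap.rTensor_comp_lTensor, LinearMap.lTensor_comp_rTensor]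

omit [IsScalarTower k Q B] in
/-- The comodule algebra `Q ⊗ B` is absolutely simple in the following sense: the composite of its
coaction with any nonzero representation of `Q ⊗ B` is injective. -/
theorem map_comp_extendCoaction_injective [Algebra.IsCentral Q B] [IsSimpleRing B]
    {ρ : B →ₐ[k] B ⊗[k] K} (hρ : IsRightCoaction ρ)
    (hinv : ∀ f : F, ρ (algebraMap F B f) = algebraMap F B f ⊗ₜ 1)
    (hfix : ∀ q : Q, ρ (algebraMap Q B q) = algebraMap Q B q ⊗ₜ 1 → ∃ f, algebraMap F Q f = q)
    {A' : Type*} [Ring A'] [Algebra k A'] [Algebra Q A'] [IsScalarTower k Q A'] [Nontrivial A']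
    (π : Q ⊗[F] B →ₐ[Q] A') :
    Function.Injective
      ((Algebra.TensorProduct.map π (AlgHom.id k K)).comp (extendCoaction Q ρ hinv)) := by
  set p := (Algebra.TensorProduct.map π (AlgHom.id k K)).comp (extendCoaction Q ρ hinv) with hp
  let N : Submodule F (Q ⊗[F] B) := (LinearMap.ker p.toLinearMap).restrictScalars F
  have hmem : ∀ x, x ∈ N ↔ p x = 0 := fun x => by simp [N]
  have hK := hopfAlgebra_nontrivial k K
  have hlmul : ∀ (b : B) (x : Q ⊗[F] B), (LinearMap.mulLeft F b).lTensor Q x = (1 ⊗ₜ b) * x := by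
    intro b x
    induction x with
    | zero => simp
    | add y z hy hz => simp only [map_add, mul_add, hy, hz]
    | tmul q c => simp
  have hrmul : ∀ (b : B) (x : Q ⊗[F] B), (LinearMap.mulRight F b).lTensor Q x = x * (1 ⊗ₜ b) := by
    intro b x
    induction x with
    | zero => simp
    | add y z hy hz => simp only [map_add, add_mul, hy, hz]
    | tmul q c => simp
  suffices hN : N = ⊥ by
    refine (injective_iff_map_eq_zero p).2 fun x hx => ?_
    have : x ∈ N := (hmem x).2 hx
    rwa [hN, Submodule.mem_bot] at this
  by_contra hN
  obtain ⟨w, hw0, hw⟩ := exists_tmul_one_mem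
    (𝒯 := Set.range fun g : K →ₗ[k] k =>
      coactionOpOver hinv g - algebraMap k F (g 1) • LinearMap.id)
    (by
      rintro _ ⟨g, rfl⟩
      have h : coactionOpOver hinv g 1 = coactionOp ρ g 1 := rfl
      simp [h, coactionOp_apply, Algebra.TensorProduct.one_def])
    (fun b hb hT => by
      have hb' : b ∈ Subalgebra.center Q B := Subalgebra.mem_center_iff.2 hb
      obtain ⟨q, rfl⟩ := Algebra.IsCentral.mem_center_iff Q |>.1 hb'
      obtain ⟨f, rfl⟩ := hfix q (eq_tmul_one_of_forall_functional _ _ fun g => by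
        have h := hT _ ⟨g, rfl⟩
        rw [LinearMap.sub_apply, sub_eq_zero] at h
        refine Eq.trans (show _ = coactionOpOver hinv g (algebraMap Q B q) from rfl) ?_
        rw [h]
        simp)
      exact ⟨f, IsScalarTower.algebraMap_apply F Q B f⟩)
    N (fun b x hx => by rw [hmem] at hx ⊢; rw [hlmul, map_mul, hx, mul_zero])
    (fun b x hx => by rw [hmem] at hx ⊢; rw [hrmul, map_mul, hx, zero_mul])
    (by
      rintro _ ⟨g, rfl⟩ x hx
      rw [LinearMap.lTensor_sub, LinearMap.sub_apply]
      refine N.sub_mem ?_ ?_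
      · rw [hmem] at hx ⊢
        rw [hp, AlgHom.comp_apply, map_extendCoaction_coactionOp hρ, ← AlgHom.comp_apply, ← hp, hx,
          map_zero]
      · rw [LinearMap.lTensor_smul, LinearMap.lTensor_id]
        exact N.smul_mem _ hx) hN
  have h1 : algebraMap Q (A' ⊗[k] K) w = 0 := by
    rw [← p.commutes, Algebra.TensorProduct.algebraMap_apply]
    exact (hmem _).1 hw
  exact hw0 ((map_eq_zero_iff _ (algebraMap Q (A' ⊗[k] K)).injective).1 h1)

/-- The map `Q ⊗ B → B ⊗ K`, `q ⊗ b ↦ (q ⊗ 1) ρ(b)`. -/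
noncomputable def smulCoaction (Q : Type*) [Field Q] [Algebra k Q] [Algebra F Q] [Algebra Q B]
    [IsScalarTower k F Q] [IsScalarTower k Q B] [IsScalarTower F Q B] (ρ : B →ₐ[k] B ⊗[k] K)
    (hinv : ∀ f : F, ρ (algebraMap F B f) = algebraMap F B f ⊗ₜ 1) :
    Q ⊗[F] B →ₐ[Q] B ⊗[k] K :=
  (Algebra.TensorProduct.map (smulAlgHom F Q B) (AlgHom.id k K)).comp (extendCoaction Q ρ hinv)

theorem smulCoaction_tmul (ρ : B →ₐ[k] B ⊗[k] K)
    (hinv : ∀ f : F, ρ (algebraMap F B f) = algebraMap F B f ⊗ₜ 1) (q : Q) (b : B) :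
    smulCoaction Q ρ hinv (q ⊗ₜ b) = q • ρ b := by
  rw [smulCoaction, AlgHom.comp_apply, extendCoaction_tmul, map_assoc_symm]
  induction ρ b with
  | zero => simp
  | add y z hy hz => simp only [smul_add, map_add, hy, hz]
  | tmul b c => simp [tmulHom, TensorProduct.smul_tmul']

/-- The coaction `id ⊗ Δ` on `B ⊗ K`. -/
noncomputable def cofreeCoaction (Q B K : Type*) [Field Q] [Algebra k Q] [Ring B] [Algebra k B]
    [Algebra Q B] [IsScalarTower k Q B] [Ring K] [HopfAlgebra k K] :
    B ⊗[k] K →ₐ[Q] (B ⊗[k] K) ⊗[k] K :=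
  (Algebra.TensorProduct.assoc k k Q B K K).symm.toAlgHom.comp
    (Algebra.TensorProduct.map (AlgHom.id Q B) (Bialgebra.comulAlgHom k K))

theorem cofreeCoaction_tmul (b : B) (c : K) :
    cofreeCoaction (k := k) Q B K (b ⊗ₜ c) =
      (TensorProduct.assoc k B K K).symm (b ⊗ₜ Coalgebra.comul (R := k) c) := rfl

theorem cofreeCoaction_apply (y : B ⊗[k] K) :
    cofreeCoaction (k := k) Q B K y =
      (TensorProduct.assoc k B K K).symm ((Coalgebra.comul (R := k)).lTensor B y) := by
  induction y with
  | zero => simp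
  | add y z hy hz => simp only [map_add, hy, hz]
  | tmul b c => rfl

theorem isRightCoaction_cofreeCoaction :
    IsRightCoaction ((cofreeCoaction (k := k) Q B K).restrictScalars k) where
  coassoc := fun y => by
    rw [AlgHom.restrictScalars_apply]
    induction y with
    | zero => simp
    | add y z hy hz => simp only [map_add, hy, hz]
    | tmul b c =>
      rw [cofreeCoaction_tmul]
      have h1 : ∀ u : K ⊗[k] K, TensorProduct.assoc k (B ⊗[k] K) K K
          ((((cofreeCoaction (k := k) Q B K).restrictScalars k).toLinearMap).rTensor K
            ((TensorProduct.assoc k B K K).symm (b ⊗ₜ u))) =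
          (TensorProduct.assoc k B K (K ⊗[k] K)).symm (b ⊗ₜ (TensorProduct.assoc k K K K
            ((Coalgebra.comul (R := k)).rTensor K u))) := fun u => by
        induction u with
        | zero => simp
        | add y z hy hz => simp only [TensorProduct.tmul_add, map_add, hy, hz]
        | tmul c c' =>
          simp only [TensorProduct.assoc_symm_tmul, LinearMap.rTensor_tmul,
            AlgHom.toLinearMap_apply, AlgHom.restrictScalars_apply, cofreeCoaction_tmul]
          induction Coalgebra.comul (R := k) c with
          | zero => simp
          | add y z hy hz => simp only [TensorProduct.tmul_add, TensorProduct.add_tmul, map_add, hy,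
              hz]
          | tmul d d' => simp
      have h2 : ∀ u : K ⊗[k] K, (Coalgebra.comul (R := k)).lTensor (B ⊗[k] K)
            ((TensorProduct.assoc k B K K).symm (b ⊗ₜ u)) =
          (TensorProduct.assoc k B K (K ⊗[k] K)).symm (b ⊗ₜ
            ((Coalgebra.comul (R := k)).lTensor K u)) := fun u => by
        induction u with
        | zero => simp
        | add y z hy hz => simp only [TensorProduct.tmul_add, map_add, hy, hz]
        | tmul c c' => simp
      rw [h1, h2, Coalgebra.coassoc_apply]
  counit := fun y => by
    rw [AlgHom.restrictScalars_apply]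
    induction y with
    | zero => simp
    | add y z hy hz => simp only [map_add, hy, hz]
    | tmul b c =>
      rw [cofreeCoaction_tmul]
      have h2 : ∀ u : K ⊗[k] K, TensorProduct.rid k _
          ((Coalgebra.counit (R := k)).lTensor (B ⊗[k] K)
            ((TensorProduct.assoc k B K K).symm (b ⊗ₜ u))) =
          b ⊗ₜ (TensorProduct.rid k _ ((Coalgebra.counit (R := k)).lTensor K u)) := fun u => by
        induction u with
        | zero => simp
        | add y z hy hz => simp only [TensorProduct.tmul_add, map_add, hy, hz]
        | tmul c c' => simp
      rw [h2, Coalgebra.lTensor_counit_comul]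
      simp

theorem cofreeCoaction_smulCoaction {ρ : B →ₐ[k] B ⊗[k] K} (hρ : IsRightCoaction ρ)
    (hinv : ∀ f : F, ρ (algebraMap F B f) = algebraMap F B f ⊗ₜ 1) (a : Q ⊗[F] B) :
    cofreeCoaction (k := k) Q B K (smulCoaction Q ρ hinv a) =
      Algebra.TensorProduct.map (smulCoaction Q ρ hinv) (AlgHom.id k K)
        (extendCoaction Q ρ hinv a) := by
  induction a with
  | zero => simp
  | add y z hy hz => simp only [map_add, hy, hz]
  | tmul q b =>
    rw [smulCoaction_tmul, extendCoaction_tmul, map_assoc_symm, map_smul, cofreeCoaction_apply,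
      ← hρ.coassoc, LinearEquiv.symm_apply_apply]
    induction ρ b with
    | zero => simp
    | add y z hy hz => simp only [smul_add, map_add, hy, hz]
    | tmul b c =>
      simp [tmulHom, smulCoaction_tmul, TensorProduct.smul_tmul']

end Generic

/-! ### The theorem for central simple algebras -/

section Bimodule

variable {Q : Type*} [Field Q]

/-- A module over a matrix algebra is a sum of `n` copies of its image under a diagonal matrix
unit. -/
theorem card_dvd_finrank_of_matrix_action {n : Type*} [Fintype n] [DecidableEq n] [Nonempty n]
    {X : Type*} [AddCommGroup X] [Module Q X] [Module.Finite Q X]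
    (f : Matrix n n Q →ₐ[Q] Module.End Q X) :
    Fintype.card n ∣ Module.finrank Q X := by
  obtain ⟨i₀⟩ := ‹Nonempty n›
  have hmul : ∀ (i j k l : n) (x : X), f (Matrix.single i j 1) (f (Matrix.single k l 1) x) =
      if j = k then f (Matrix.single i l 1) x else 0 := fun i j k l x => by
    rw [← Module.End.mul_apply, ← map_mul]
    split_ifs with h
    · subst h; simp
    · simp [h]
  let V := LinearMap.range (f (Matrix.single i₀ i₀ 1))
  let e : X ≃ₗ[Q] (n → V) :=
    { toFun := fun x i => ⟨f (Matrix.single i₀ i 1) x, f (Matrix.single i₀ i 1) x, by simp [hmul]⟩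
      map_add' := fun x y => by ext; simp
      map_smul' := fun c x => by ext; simp
      invFun := fun v => ∑ i, f (Matrix.single i i₀ 1) (v i)
      left_inv := fun x => by
        simp only [hmul, if_true]
        rw [← LinearMap.sum_apply, ← map_sum, Matrix.sum_single_one]
        simp
      right_inv := fun v => by
        refine funext fun i => Subtype.ext ?_
        obtain ⟨y, hy⟩ := (v i).2
        simp [hmul, ← hy] }
  rw [e.finrank_eq, Module.finrank_pi_fintype]
  simp

variable {B : Type*} [Ring B] [Algebra Q B] [FiniteDimensional Q B] [Algebra.IsCentral Q B]
  [IsSimpleRing B]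

/-- A central simple algebra is an Azumaya algebra: injectivity is a minimal length argument, and
the dimensions agree. -/
theorem mulLeftRight_bijective : Function.Bijective (AlgHom.mulLeftRight Q B) := by
  have hinj : Function.Injective (AlgHom.mulLeftRight Q B).toLinearMap := by
    rw [← LinearMap.ker_eq_bot]
    by_contra hN
    have hL : ∀ (b : Bᵐᵒᵖ) (x : B ⊗[Q] Bᵐᵒᵖ),
        (LinearMap.mulLeft Q b).lTensor B x = (1 ⊗ₜ b) * x := by
      intro b x
      induction x with
      | zero => simp
      | add y z hy hz => simp only [map_add, mul_add, hy, hz]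
      | tmul q c => simp
    have hR : ∀ (b : Bᵐᵒᵖ) (x : B ⊗[Q] Bᵐᵒᵖ),
        (LinearMap.mulRight Q b).lTensor B x = x * (1 ⊗ₜ b) := by
      intro b x
      induction x with
      | zero => simp
      | add y z hy hz => simp only [map_add, add_mul, hy, hz]
      | tmul q c => simp
    obtain ⟨w, hw0, hw⟩ := exists_tmul_one_mem (F := Q) (W := B) (B := Bᵐᵒᵖ) ∅ (by simp)
      (fun b hb _ => by
        have hb' : b ∈ Subalgebra.center Q Bᵐᵒᵖ := Subalgebra.mem_center_iff.2 hb
        obtain ⟨q, rfl⟩ := Algebra.IsCentral.mem_center_iff Q |>.1 hb'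
        exact ⟨q, rfl⟩) _
      (fun b x hx => by
        rw [LinearMap.mem_ker, AlgHom.toLinearMap_apply] at hx ⊢
        rw [hL, map_mul, hx, mul_zero])
      (fun b x hx => by
        rw [LinearMap.mem_ker, AlgHom.toLinearMap_apply] at hx ⊢
        rw [hR, map_mul, hx, zero_mul])
      (by simp) hN
    have h := LinearMap.congr_fun (LinearMap.mem_ker.1 hw) (1 : B)
    exact hw0 (by simpa using h)
  refine ⟨hinj, (LinearMap.injective_iff_surjective_of_finrank_eq_finrank ?_).1 hinj⟩
  rw [Module.finrank_tensorProduct, Module.finrank_linearMap,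
    (MulOpposite.opLinearEquiv Q (M := B)).finrank_eq]

/-- A bimodule over a central simple algebra is a sum of copies of the algebra. -/
theorem finrank_dvd_finrank_of_bimodule {X : Type*} [AddCommGroup X] [Module Q X]
    [Module.Finite Q X] (f : B ⊗[Q] Bᵐᵒᵖ →ₐ[Q] Module.End Q X) :
    Module.finrank Q B ∣ Module.finrank Q X := by
  let e := AlgEquiv.ofBijective _ (mulLeftRight_bijective (Q := Q) (B := B))
  have hpos : 0 < Module.finrank Q B := Module.finrank_pos
  have : Nonempty (Fin (Module.finrank Q B)) := ⟨⟨0, hpos⟩⟩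
  simpa using card_dvd_finrank_of_matrix_action
    ((f.comp e.symm.toAlgHom).comp
      (LinearMap.toMatrixAlgEquiv (Module.finBasis Q B)).symm.toAlgHom)

end Bimodule

section Core

variable {k F Q B K : Type*} [Field k] [Field F] [Field Q] [Algebra k F] [Algebra k Q] [Algebra F Q]
  [IsScalarTower k F Q] [Ring K] [HopfAlgebra k K] [FiniteDimensional k K]
  [Ring B] [Algebra k B] [Algebra F B] [Algebra Q B] [IsScalarTower k F B] [IsScalarTower k Q B]
  [IsScalarTower F Q B] [FiniteDimensional Q B]

/-- The bimodule structure on the right linear maps `B ⊗ K → B`. -/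
noncomputable def rightHomBimodule {A : Type*} [Ring A] [Algebra Q A] (j : A →ₐ[Q] B ⊗[k] K)
    (μ : A →ₐ[Q] B) : B ⊗[Q] Bᵐᵒᵖ →ₐ[Q] Module.End Q (rightHom j μ) :=
  Algebra.TensorProduct.lift
    { toFun := fun b =>
        { toFun := fun u => ⟨LinearMap.mulLeft Q b ∘ₗ u.1, fun e a => by simp [u.2 e a, mul_assoc]⟩
          map_add' := fun u v => by ext; simp [mul_add]
          map_smul' := fun c u => by ext; simp }
      map_one' := by ext; simp
      map_mul' := fun b b' => by ext; simp
      map_zero' := by ext; simp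
      map_add' := fun b b' => by ext; simp [add_mul]
      commutes' := fun q => by ext; simp [Algebra.smul_def] }
    { toFun := fun b =>
        { toFun := fun u => ⟨u.1 ∘ₗ LinearMap.mulLeft Q (b.unop ⊗ₜ[k] (1 : K)),
            fun e a => by simp [← mul_assoc, u.2 _ a]⟩
          map_add' := fun u v => by ext; simp
          map_smul' := fun c u => by ext; simp }
      map_one' := by ext; simp [← Algebra.TensorProduct.one_def]
      map_mul' := fun b b' => by
        ext u e
        simp [← mul_assoc]
      map_zero' := by ext; simp
      map_add' := fun b b' => by ext; simp [add_mul, TensorProduct.add_tmul]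
      commutes' := fun q => by
        refine LinearMap.ext fun u => Subtype.ext (LinearMap.ext fun e => ?_)
        have : (algebraMap Q B q ⊗ₜ[k] (1 : K)) * e = q • e := by
          rw [Algebra.smul_def, Algebra.TensorProduct.algebraMap_apply]
        simp [MulOpposite.algebraMap_apply, this] }
    fun b b' => by
      ext u e
      simp

variable [Algebra.IsCentral Q B] [IsSimpleRing B]

/-- The injection of `Q ⊗[F] B` into `B ⊗ K` bounds the dimension of `B` over `F`. -/
theorem finiteDimensional_of_smulCoaction {ρ : B →ₐ[k] B ⊗[k] K} (hρ : IsRightCoaction ρ)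
    (hinv : ∀ f : F, ρ (algebraMap F B f) = algebraMap F B f ⊗ₜ 1)
    (hfix : ∀ q : Q, ρ (algebraMap Q B q) = algebraMap Q B q ⊗ₜ 1 → ∃ f, algebraMap F Q f = q) :
    FiniteDimensional F B := by
  have hj : Function.Injective (smulCoaction Q ρ hinv) :=
    map_comp_extendCoaction_injective hρ hinv hfix _
  have h1 : FiniteDimensional Q (Q ⊗[F] B) :=
    Module.Finite.of_injective (smulCoaction Q ρ hinv).toLinearMap hj
  rw [FiniteDimensional, ← Module.rank_lt_aleph0_iff] at h1 ⊢
  rw [Module.rank_baseChange] at h1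
  simpa using h1

/-- Some power of `B ⊗ K` is a free right module over `Q ⊗ B`. -/
theorem exists_free_power {ρ : B →ₐ[k] B ⊗[k] K} (hρ : IsRightCoaction ρ)
    (hinv : ∀ f : F, ρ (algebraMap F B f) = algebraMap F B f ⊗ₜ 1)
    (hfix : ∀ q : Q, ρ (algebraMap Q B q) = algebraMap Q B q ⊗ₜ 1 → ∃ f, algebraMap F Q f = q) :
    ∃ (s t : ℕ) (x : Fin s → Fin t → B ⊗[k] K), 0 < t ∧
      RightGenerates (smulCoaction Q ρ hinv) x ∧
      ∀ v : Fin s → Q ⊗[F] B, (∀ l, ∑ i, x i l * smulCoaction Q ρ hinv (v i) = 0) → v = 0 := by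
  have := finiteDimensional_of_smulCoaction hρ hinv hfix
  obtain ⟨S, _, _, _, _, π, s, t, x, ht, hx, hdim⟩ := exists_rightGenerates (smulCoaction Q ρ hinv)
  let : Algebra k (Module.End Q S)ᵐᵒᵖ := Algebra.compHom _ (algebraMap k Q)
  have : IsScalarTower k Q (Module.End Q S)ᵐᵒᵖ := IsScalarTower.of_algebraMap_eq fun _ => rfl
  exact ⟨s, t, x, ht, hx, rightGenerates_independent (cofreeCoaction_smulCoaction hρ hinv)
    isRightCoaction_cofreeCoaction π (map_comp_extendCoaction_injective hρ hinv hfix π) hx hdim⟩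

/-- The divisibility for a coaction on a central simple algebra `B`, where the hypotheses `hinv` and
`hfix` say that `F` is the field of invariant elements of `Q`. -/
theorem finrank_dvd_of_coaction {ρ : B →ₐ[k] B ⊗[k] K} (hρ : IsRightCoaction ρ)
    (hinv : ∀ f : F, ρ (algebraMap F B f) = algebraMap F B f ⊗ₜ 1)
    (hfix : ∀ q : Q, ρ (algebraMap Q B q) = algebraMap Q B q ⊗ₜ 1 → ∃ f, algebraMap F Q f = q) :
    FiniteDimensional F Q ∧ Module.finrank F Q ∣ Module.finrank k K := by
  have hFB := finiteDimensional_of_smulCoaction hρ hinv hfix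
  have hFQ : FiniteDimensional F Q := FiniteDimensional.left F Q B
  refine ⟨hFQ, ?_⟩
  obtain ⟨s, t, x, ht, hx, hinj⟩ := exists_free_power hρ hinv hfix
  have h1 := (LinearEquiv.ofBijective _ (rightCombination_bijective hx hinj)).finrank_eq
  rw [finrank_fin_fun, finrank_fin_fun, Module.finrank_baseChange, Module.finrank_tensorProduct,
    ← Module.finrank_mul_finrank F Q B] at h1
  have h2 := finrank_rightHom_of_free (smulAlgHom F Q B) hx hinj
  obtain ⟨c, hc⟩ := finrank_dvd_finrank_of_bimodule (Q := Q) (B := B)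
    (X := rightHom (smulCoaction Q ρ hinv) (smulAlgHom F Q B))
    (rightHomBimodule (smulCoaction Q ρ hinv) (smulAlgHom F Q B))
  have hpos : 0 < Module.finrank Q B := Module.finrank_pos
  rw [hc] at h2
  -- `t c dim B = s dim B`, and then `t dim B dim K = t c [Q : F] dim B`
  have h3 : t * c = s := Nat.eq_of_mul_eq_mul_left hpos (by linarith)
  subst h3
  refine ⟨c, Nat.eq_of_mul_eq_mul_left (Nat.mul_pos ht hpos) ?_⟩
  linarith

/-- On the free module `(B ⊗ K) ^ t` over `Q ⊗[F] B`, right multiplication by `ρ b` acts as right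
multiplication by `1 ⊗ b`, whose determinant comes from `F`. -/
theorem exists_det_pow_eq_algebraMap {ρ : B →ₐ[k] B ⊗[k] K} (hρ : IsRightCoaction ρ)
    (hinv : ∀ f : F, ρ (algebraMap F B f) = algebraMap F B f ⊗ₜ 1)
    (hfix : ∀ q : Q, ρ (algebraMap Q B q) = algebraMap Q B q ⊗ₜ 1 → ∃ f, algebraMap F Q f = q) :
    ∃ t : ℕ, 0 < t ∧ ∀ b : B, ∃ f : F,
      algebraMap F Q f = (LinearMap.mulRight Q (ρ b)).det ^ t := by
  have hFB := finiteDimensional_of_smulCoaction hρ hinv hfix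
  obtain ⟨s, t, x, ht, hx, hinj⟩ := exists_free_power hρ hinv hfix
  refine ⟨t, ht, fun b => ⟨(LinearMap.mulRight F b).det ^ s, ?_⟩⟩
  let e := LinearEquiv.ofBijective _ (rightCombination_bijective hx hinj)
  have h1 : (LinearMap.mulRight Q ((1 : Q) ⊗ₜ[F] b)).det =
      algebraMap F Q (LinearMap.mulRight F b).det := by
    rw [← LinearMap.det_baseChange]
    congr 1
    ext
    simp
  have h2 := LinearMap.det_pi (fun _ : Fin t => LinearMap.mulRight Q (ρ b))
  have h3 := LinearMap.det_pi (fun _ : Fin s => LinearMap.mulRight Q ((1 : Q) ⊗ₜ[F] b))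
  rw [Finset.prod_const, Finset.card_univ, Fintype.card_fin] at h2 h3
  rw [map_pow, ← h1, ← h2, ← h3, ← LinearMap.det_conj _ e]
  congr 1
  refine LinearMap.ext fun y => ?_
  obtain ⟨v, rfl⟩ := e.surjective y
  have h4 := rightCombination_mul (smulCoaction Q ρ hinv) x v (1 ⊗ₜ b)
  rw [smulCoaction_tmul, one_smul] at h4
  simp only [LinearMap.comp_apply, LinearEquiv.coe_coe, LinearEquiv.symm_apply_apply]
  exact h4

end Core

/-! ### Central localization of a coaction -/

section Localization

variable {k Z Q A B T : Type*} [Field k] [CommRing Z] [IsDomain Z] [Field Q] [Algebra Z Q]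
  [IsFractionRing Z Q] [Ring A] [Algebra k A] [Algebra Z A] [Ring B] [Algebra k B] [Algebra Q B]
  [Ring T] [Algebra k T]

omit [IsFractionRing Z Q] in
/-- An algebra map out of `A` that inverts the nonzero elements of `Z` extends to any algebra `B`
obtained from `A` by central localization at these elements. -/
theorem exists_extension_of_isUnit (ι : A →ₐ[k] B)
    (hι : Function.Injective ι)
    (hιZ : ∀ z, ι (algebraMap Z A z) = algebraMap Q B (algebraMap Z Q z))
    (hloc : ∀ b : B, ∃ z : Z, z ≠ 0 ∧ ∃ a, ι (algebraMap Z A z) * b = ι a)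
    (r : A →ₐ[k] T) (hr : ∀ z : Z, z ≠ 0 → IsUnit (r (algebraMap Z A z))) :
    ∃ R : B →ₐ[k] T, ∀ a, R (ι a) = r a := by
  choose d hd n hn using hloc
  obtain ⟨R, hR0⟩ : ∃ R : B → T, ∀ b, r (algebraMap Z A (d b)) * R b = r (n b) :=
    ⟨fun b => Ring.inverse (r (algebraMap Z A (d b))) * r (n b), fun b => by
      rw [← mul_assoc, Ring.mul_inverse_cancel _ (hr _ (hd b)), one_mul]⟩
  have hR : ∀ (z : Z) (b : B) (a : A), z ≠ 0 → ι (algebraMap Z A z) * b = ι a →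
      r (algebraMap Z A z) * R b = r a := by
    intro z b a hz h
    have h1 : algebraMap Z A z * n b = algebraMap Z A (d b) * a := by
      refine hι ?_
      rw [map_mul, map_mul, ← hn, ← h, ← mul_assoc, ← mul_assoc, ← map_mul, ← map_mul ι,
        (Algebra.commute_algebraMap_left z _).eq]
    refine (hr _ (hd b)).mul_left_cancel ?_
    rw [← map_mul, ← h1, map_mul, ← hR0, ← mul_assoc, ← mul_assoc, ← map_mul, ← map_mul r,
      (Algebra.commute_algebraMap_left z _).eq]
  -- an element of `T` is determined by its product with a denominator
  have huniq : ∀ (z : Z) (b : B) (a : A) (y : T), z ≠ 0 → ι (algebraMap Z A z) * b = ι a →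
      r (algebraMap Z A z) * y = r a → R b = y := fun z b a y hz h hy =>
    (hr z hz).mul_left_cancel ((hR z b a hz h).trans hy.symm)
  have hcomm : ∀ (z : Z) (b : B), ι (algebraMap Z A z) * b = b * ι (algebraMap Z A z) :=
    fun z b => by rw [hιZ, Algebra.commutes]
  refine ⟨⟨⟨⟨⟨R, ?_⟩, ?_⟩, ?_, ?_⟩, ?_⟩, fun a => ?_⟩
  · exact huniq 1 1 1 1 one_ne_zero (by simp) (by simp)
  · intro b c
    refine huniq (d b * d c) _ (n b * n c) _ (mul_ne_zero (hd b) (hd c)) ?_ ?_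
    · rw [map_mul, map_mul, map_mul, ← hn, ← hn]
      simp only [mul_assoc]
      rw [← mul_assoc _ b c, hcomm _ b]
      simp only [mul_assoc]
    · have h1 := hR _ b _ (hd b) (hn b)
      have h2 := hR _ c _ (hd c) (hn c)
      change _ * (R b * R c) = _
      rw [mul_comm (d b), map_mul, map_mul, map_mul, ← h2, ← mul_assoc, mul_assoc (r _) (r _) (R b),
        h1, ← mul_assoc, ← map_mul, ← map_mul, (Algebra.commute_algebraMap_left (d c) _).eq]
  · exact huniq 1 0 0 0 one_ne_zero (by simp) (by simp)
  · intro b c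
    refine huniq (d b * d c) _ (algebraMap Z A (d c) * n b + algebraMap Z A (d b) * n c) _
      (mul_ne_zero (hd b) (hd c)) ?_ ?_
    · rw [map_add, map_mul ι, map_mul ι, ← hn, ← hn, ← mul_assoc, ← mul_assoc, ← map_mul, ← map_mul,
        ← map_mul, ← map_mul, mul_comm (d c), mul_add]
    · change _ * (R b + R c) = _
      rw [map_add, map_mul r, map_mul r, ← hR _ b _ (hd b) (hn b), ← hR _ c _ (hd c) (hn c),
        ← mul_assoc, ← mul_assoc, ← map_mul, ← map_mul, ← map_mul, ← map_mul, mul_comm (d c),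
        mul_add]
  · intro c
    exact huniq 1 _ (algebraMap k A c) _ one_ne_zero (by simp) (by simp)
  · exact huniq 1 _ a _ one_ne_zero (by simp) (by simp)

omit [IsDomain Z] in
theorem algHom_ext_of_localization (ι : A →ₐ[k] B)
    (hιZ : ∀ z, ι (algebraMap Z A z) = algebraMap Q B (algebraMap Z Q z))
    (hloc : ∀ b : B, ∃ z : Z, z ≠ 0 ∧ ∃ a, ι (algebraMap Z A z) * b = ι a)
    {R R' : B →ₐ[k] T} (h : ∀ a, R (ι a) = R' (ι a)) : R = R' := by
  ext b
  obtain ⟨z, hz, a, ha⟩ := hloc b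
  have hu : IsUnit (ι (algebraMap Z A z)) := by
    rw [hιZ]
    refine (IsUnit.mk0 _ ?_).map _
    simpa using hz
  refine (hu.map R).mul_left_cancel ?_
  rw [← map_mul, ha, h, h, ← map_mul, ha]

end Localization

section ExtendCoaction

variable {k Z Q A B K : Type*} [Field k] [CommRing Z] [IsDomain Z] [Field Q] [Algebra Z Q]
  [IsFractionRing Z Q] [Algebra k Q] [Ring A] [Algebra k A] [Algebra Z A]
  [Ring B] [Algebra k B] [Algebra Q B] [IsScalarTower k Q B] [FiniteDimensional Q B]
  [Ring K] [HopfAlgebra k K]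

/-- A coaction `ρB` on `B` extends a coaction `ρ` on `A` along `ι`. -/
def ExtendsCoaction (ι : A →ₐ[k] B) (ρ : A →ₐ[k] A ⊗[k] K) (ρB : B →ₐ[k] B ⊗[k] K) : Prop :=
  ∀ a, ρB (ι a) = Algebra.TensorProduct.map ι (AlgHom.id k K) (ρ a)

omit [IsDomain Z] [Algebra k Q] [IsScalarTower k Q B] [FiniteDimensional Q B] in
/-- The comodule axioms are equalities of algebra maps on `B`, so it is enough to check them
on `A`. -/
theorem ExtendsCoaction.isRightCoaction {ι : A →ₐ[k] B}
    (hιZ : ∀ z, ι (algebraMap Z A z) = algebraMap Q B (algebraMap Z Q z))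
    (hloc : ∀ b : B, ∃ z : Z, z ≠ 0 ∧ ∃ a, ι (algebraMap Z A z) * b = ι a)
    {ρ : A →ₐ[k] A ⊗[k] K} (hρ : IsRightCoaction ρ) {ρB : B →ₐ[k] B ⊗[k] K}
    (hB : ExtendsCoaction ι ρ ρB) : IsRightCoaction ρB where
  coassoc b := by
    let R : B →ₐ[k] B ⊗[k] (K ⊗[k] K) := (Algebra.TensorProduct.assoc k k k B K K).toAlgHom.comp
      ((Algebra.TensorProduct.map ρB (AlgHom.id k K)).comp ρB)
    let R' : B →ₐ[k] B ⊗[k] (K ⊗[k] K) :=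
      (Algebra.TensorProduct.map (AlgHom.id k B) (Bialgebra.comulAlgHom k K)).comp ρB
    have hR : ∀ b, R b = TensorProduct.assoc k B K K (ρB.toLinearMap.rTensor K (ρB b)) :=
      fun b => rfl
    have hR' : ∀ b, R' b = (Coalgebra.comul (R := k) (A := K)).lTensor B (ρB b) := fun b => rfl
    have h : R = R' := by
      refine algHom_ext_of_localization ι hιZ hloc fun a => ?_
      rw [hR, hR', hB]
      have h1 : ∀ y : A ⊗[k] K, TensorProduct.assoc k B K K (ρB.toLinearMap.rTensor K
          (Algebra.TensorProduct.map ι (AlgHom.id k K) y)) = ι.toLinearMap.rTensor (K ⊗[k] K)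
            (TensorProduct.assoc k A K K (ρ.toLinearMap.rTensor K y)) := fun y => by
        induction y with
        | zero => simp
        | add y z hy hz => simp only [map_add, hy, hz]
        | tmul x c =>
          simp only [Algebra.TensorProduct.map_tmul, LinearMap.rTensor_tmul,
            AlgHom.toLinearMap_apply, hB x, AlgHom.id_apply]
          induction ρ x with
          | zero => simp
          | add y z hy hz => simp only [map_add, TensorProduct.add_tmul, hy, hz]
          | tmul x' c' => simp
      have h2 : ∀ y : A ⊗[k] K, (Coalgebra.comul (R := k) (A := K)).lTensor B
          (Algebra.TensorProduct.map ι (AlgHom.id k K) y) = ι.toLinearMap.rTensor (K ⊗[k] K)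
            ((Coalgebra.comul (R := k) (A := K)).lTensor A y) := fun y => by
        induction y with
        | zero => simp
        | add y z hy hz => simp only [map_add, hy, hz]
        | tmul x c => simp
      rw [h1, h2, hρ.coassoc]
    rw [← hR, ← hR', h]
  counit b := by
    let R : B →ₐ[k] B := (Algebra.TensorProduct.rid k k B).toAlgHom.comp
      ((Algebra.TensorProduct.map (AlgHom.id k B) (Bialgebra.counitAlgHom k K)).comp ρB)
    have hR : ∀ b, R b = TensorProduct.rid k B
        ((Coalgebra.counit (R := k) (A := K)).lTensor B (ρB b)) := fun b => rfl
    have h : R = AlgHom.id k B := by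
      refine algHom_ext_of_localization ι hιZ hloc fun a => ?_
      rw [hR, hB]
      have h2 : ∀ y : A ⊗[k] K, TensorProduct.rid k B
          ((Coalgebra.counit (R := k) (A := K)).lTensor B
          (Algebra.TensorProduct.map ι (AlgHom.id k K) y)) =
            ι (TensorProduct.rid k A ((Coalgebra.counit (R := k) (A := K)).lTensor A y)) :=
        fun y => by
          induction y with
          | zero => simp
          | add y z hy hz => simp only [map_add, hy, hz]
          | tmul x c => simp
      rw [h2, hρ.counit]
      rfl
    rw [← hR, h]
    rfl

/-- Denominators in `B ⊗ K` can be cleared. -/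
theorem exists_clear_denominator {ι : A →ₐ[k] B}
    (hloc : ∀ b : B, ∃ z : Z, z ≠ 0 ∧ ∃ a, ι (algebraMap Z A z) * b = ι a) (y : B ⊗[k] K) :
    ∃ z : Z, z ≠ 0 ∧ ∃ x : A ⊗[k] K, (ι (algebraMap Z A z) ⊗ₜ 1) * y =
      Algebra.TensorProduct.map ι (AlgHom.id k K) x := by
  induction y with
  | zero => exact ⟨1, one_ne_zero, 0, by simp⟩
  | add y y' hy hy' =>
    obtain ⟨z, hz, x, hx⟩ := hy
    obtain ⟨z', hz', x', hx'⟩ := hy'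
    refine ⟨z * z', mul_ne_zero hz hz', (algebraMap Z A z' ⊗ₜ 1) * x + (algebraMap Z A z ⊗ₜ 1) * x',
      ?_⟩
    have hz1 : ι (algebraMap Z A (z * z')) ⊗ₜ[k] (1 : K) =
        (ι (algebraMap Z A z') ⊗ₜ 1) * (ι (algebraMap Z A z) ⊗ₜ 1) := by
      rw [mul_comm z]; simp
    have hz2 : ι (algebraMap Z A (z * z')) ⊗ₜ[k] (1 : K) =
        (ι (algebraMap Z A z) ⊗ₜ 1) * (ι (algebraMap Z A z') ⊗ₜ 1) := by simp
    rw [mul_add, map_add, map_mul (Algebra.TensorProduct.map ι _),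
      map_mul (Algebra.TensorProduct.map ι _), ← hx, ← hx']
    congr 1
    · rw [hz1, mul_assoc]; simp
    · rw [hz2, mul_assoc]; simp
  | tmul b c =>
    obtain ⟨z, hz, a, ha⟩ := hloc b
    exact ⟨z, hz, a ⊗ₜ c, by simp [ha]⟩

/-- In the finite-dimensional algebra `B ⊗ K` the image of `ρ z` is invertible, because it is
regular. -/
theorem isUnit_map_coaction [FiniteDimensional k K] {ι : A →ₐ[k] B}
    (hι : Function.Injective ι)
    (hιZ : ∀ z, ι (algebraMap Z A z) = algebraMap Q B (algebraMap Z Q z))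
    (hloc : ∀ b : B, ∃ z : Z, z ≠ 0 ∧ ∃ a, ι (algebraMap Z A z) * b = ι a)
    {ρ : A →ₐ[k] A ⊗[k] K} (hρ : IsRightCoaction ρ) (z : Z) (hz : z ≠ 0) :
    IsUnit (Algebra.TensorProduct.map ι (AlgHom.id k K) (ρ (algebraMap Z A z))) := by
  have hmapinj : Function.Injective (Algebra.TensorProduct.map ι (AlgHom.id k K)) :=
    Module.Flat.rTensor_preserves_injective_linearMap (M := K) ι.toLinearMap hι
  have hreg : ∀ w : Z, w ≠ 0 → IsUnit (ι (algebraMap Z A w) ⊗ₜ[k] (1 : K)) := fun w hw => by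
    rw [hιZ]
    have h1 : IsUnit (algebraMap Z Q w) := IsUnit.mk0 _ (by simpa using hw)
    exact h1.map (algebraMap Q (B ⊗[k] K))
  have hregA : IsLeftRegular (algebraMap Z A z ⊗ₜ[k] (1 : K)) := by
    intro x y h
    refine hmapinj ((hreg z hz).mul_left_cancel ?_)
    have h1 := congrArg (Algebra.TensorProduct.map ι (AlgHom.id k K)) h
    simpa using h1
  have hregρ := hρ.isLeftRegular_apply hregA
  set u := Algebra.TensorProduct.map ι (AlgHom.id k K) (ρ (algebraMap Z A z)) with hu
  have hinj : ∀ y : B ⊗[k] K, u * y = 0 → y = 0 := by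
    intro y hy
    obtain ⟨w, hw, x, hx⟩ := exists_clear_denominator hloc y
    have hcomm : (ι (algebraMap Z A w) ⊗ₜ[k] (1 : K)) * u = u * (ι (algebraMap Z A w) ⊗ₜ 1) := by
      rw [hιZ]
      exact Algebra.commutes (algebraMap Z Q w) u
    have h1 : u * Algebra.TensorProduct.map ι (AlgHom.id k K) x = 0 := by
      rw [← hx, ← mul_assoc, ← hcomm, mul_assoc, hy, mul_zero]
    rw [hu, ← map_mul, map_eq_zero_iff _ hmapinj] at h1
    have h2 : x = 0 := hregρ (by simpa using h1)
    rw [h2, map_zero] at hx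
    exact (hreg w hw).mul_left_cancel (by simpa using hx)
  have hinj' : Function.Injective (LinearMap.mulLeft Q u) :=
    (injective_iff_map_eq_zero _).2 fun y hy => hinj y hy
  obtain ⟨y, hy⟩ := (LinearMap.injective_iff_surjective.1 hinj') 1
  rw [LinearMap.mulLeft_apply] at hy
  exact ⟨⟨u, y, hy, sub_eq_zero.1 (hinj _ (by
    rw [mul_sub, ← mul_assoc, hy, one_mul, mul_one, sub_self]))⟩, rfl⟩

end ExtendCoaction

/-! ### Characteristic polynomials with coefficients in a subring -/

section Charpoly

open Polynomial

/-- The matrix `X - M` divides `p(X) - p(M) = p(X)`; take determinants. -/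
theorem charpoly_dvd_pow_of_aeval_eq_zero {Q V : Type*} [Field Q] [AddCommGroup V] [Module Q V]
    [FiniteDimensional Q V] (f : Module.End Q V) (p : Q[X]) (hp : aeval f p = 0) :
    f.charpoly ∣ p ^ Module.finrank Q V := by
  classical
  let b := Module.finBasis Q V
  let M := LinearMap.toMatrixAlgEquiv b f
  have hM : aeval M p = 0 := by rw [aeval_algHom_apply, hp, map_zero]
  -- inside the commutative algebra generated by `M` over `Q[X]`, `X - M` divides `p(X) - p(M)`
  let M' : Matrix (Fin _) (Fin _) Q[X] := C.mapMatrix M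
  let S := Algebra.adjoin Q[X] {M'}
  have : IsMulCommutative S := Algebra.isMulCommutative_adjoin Q[X] (by simp)
  let m : S := ⟨M', Algebra.subset_adjoin rfl⟩
  obtain ⟨c, hc⟩ := sub_dvd_eval_sub (algebraMap Q[X] S X) m (p.map (algebraMap Q S))
  have hX : eval (algebraMap Q[X] S X) (p.map (algebraMap Q S)) = algebraMap Q[X] S p := by
    rw [eval_map_algebraMap, ← Polynomial.aeval_X_left_apply p, aeval_algebraMap_apply]
    simp
  have hm : (eval m (p.map (algebraMap Q S))).1 = 0 := by
    have e1 : (eval m (p.map (algebraMap Q S))).1 = aeval M' p := by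
      rw [eval_map_algebraMap]
      exact (aeval_algHom_apply (S.val.restrictScalars Q) m p).symm
    have e2 : aeval M' p = CAlgHom.mapMatrix (aeval M p) :=
      aeval_algHom_apply (CAlgHom (R := Q) (A := Q)).mapMatrix M p
    rw [e1, e2, hM, map_zero]
  have hdet : M.charmatrix * c.1 = algebraMap Q[X] (Matrix _ _ Q[X]) p := by
    have := congrArg Subtype.val hc
    rw [hX] at this
    change (algebraMap Q[X] (Matrix _ _ Q[X]) p) - (eval m (p.map (algebraMap Q S))).1 = _ at this
    rw [hm, sub_zero] at this
    rw [this]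
    rfl
  have h2 := congrArg Matrix.det hdet
  rw [Matrix.det_mul, Algebra.algebraMap_eq_smul_one, Matrix.det_smul, Matrix.det_one, mul_one,
    Fintype.card_fin] at h2
  have h3 : f.charpoly = M.charmatrix.det := by
    rw [← LinearMap.charpoly_toMatrix f b]; rfl
  rw [h3, ← h2]
  exact dvd_mul_right _ _

/-- Over an integrally closed domain, the characteristic polynomial of an integral endomorphism has
integral coefficients, being a monic factor of a power of an integral equation. -/
theorem exists_map_eq_charpoly_of_isIntegrallyClosed {Z Q V : Type*} [CommRing Z] [IsDomain Z]
    [Field Q] [Algebra Z Q]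
    [IsFractionRing Z Q] [IsIntegrallyClosed Z] [AddCommGroup V] [Module Q V]
    [FiniteDimensional Q V] (f : Module.End Q V) (p : Z[X]) (hm : p.Monic)
    (hp : aeval f (p.map (algebraMap Z Q)) = 0) :
    ∃ χ : Z[X], χ.map (algebraMap Z Q) = f.charpoly := by
  have h1 := charpoly_dvd_pow_of_aeval_eq_zero f _ hp
  rw [← Polynomial.map_pow] at h1
  obtain ⟨χ, hχ⟩ := IsIntegrallyClosed.eq_map_mul_C_of_dvd Q (hm.pow _) h1
  refine ⟨χ, ?_⟩
  rwa [f.charpoly_monic.leadingCoeff, C_1, mul_one] at hχ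

/-- The endomorphisms `f ∘ g` and `g ∘ f` have the same characteristic polynomial, up to a power
of `X`. -/
theorem charpoly_comp_comm {Q V W : Type*} [Field Q] [AddCommGroup V] [Module Q V]
    [FiniteDimensional Q V] [AddCommGroup W] [Module Q W] [FiniteDimensional Q W]
    (f : V →ₗ[Q] W) (g : W →ₗ[Q] V) :
    X ^ Module.finrank Q V * (f ∘ₗ g).charpoly = X ^ Module.finrank Q W * (g ∘ₗ f).charpoly := by
  classical
  let b := Module.finBasis Q V
  let c := Module.finBasis Q W
  rw [← LinearMap.charpoly_toMatrix _ b, ← LinearMap.charpoly_toMatrix _ c,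
    LinearMap.toMatrix_comp c b c, LinearMap.toMatrix_comp b c b]
  simpa using Matrix.charpoly_mul_comm' (LinearMap.toMatrix b c f) (LinearMap.toMatrix c b g)

/-- The characteristic polynomial of an endomorphism of a finite projective module, computed over
the fraction field, has coefficients in the base ring: a complement turns the endomorphism into one
of a free module, and the characteristic polynomial changes by a power of `X`. -/
theorem exists_map_eq_charpoly_of_projective {Z Q L : Type*} [CommRing Z]
    [Field Q] [Algebra Z Q] [AddCommGroup L] [Module Z L] [Module.Finite Z L]
    [Module.Projective Z L]
    (f : Module.End Z L) :
    ∃ χ : Z[X], χ.map (algebraMap Z Q) = (f.baseChange Q).charpoly := by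
  obtain ⟨n, π, i, -, -, hπi⟩ := Module.Finite.exists_comp_eq_id_of_projective Z L
  have h1 := charpoly_comp_comm (i.baseChange Q) ((f ∘ₗ π).baseChange Q)
  have h2 : (f ∘ₗ π).baseChange Q ∘ₗ i.baseChange Q = f.baseChange Q := by
    rw [← LinearMap.baseChange_comp, LinearMap.comp_assoc, hπi, LinearMap.comp_id]
  rw [h2, ← LinearMap.baseChange_comp, LinearMap.charpoly_baseChange] at h1
  have h3 : (f.baseChange Q).charpoly ∈ lifts (algebraMap Z Q) := by
    rw [lifts_iff_coeff_lifts]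
    intro m
    have h4 := congrArg (fun p => p.coeff (m + Module.finrank Q (Q ⊗[Z] (Fin n → Z)))) h1
    simp only [coeff_X_pow_mul] at h4
    rw [← h4, ← Polynomial.map_X (algebraMap Z Q), ← Polynomial.map_pow, ← Polynomial.map_mul,
      coeff_map]
    exact ⟨_, rfl⟩
  exact (mem_lifts _).1 h3

end Charpoly

/-! ### Invariant multiples of central elements -/

section InvariantField

open Polynomial

variable {k Q B K : Type*} [Field k] [Field Q] [Algebra k Q] [Ring K] [HopfAlgebra k K]
  [Ring B] [Algebra k B] [Algebra Q B] [IsScalarTower k Q B]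

theorem mem_invariantsIn {Z A : Type*} [Ring A] [Algebra k A] [CommRing Z] [Algebra k Z]
    [Algebra Z A] [IsScalarTower k Z A] {ρ : A →ₐ[k] A ⊗[k] K} {z : Z} :
    z ∈ invariantsIn Z ρ ↔ ρ (algebraMap Z A z) = algebraMap Z A z ⊗ₜ 1 := Iff.rfl

/-- The invariants of a coaction in a central field form a field. -/
noncomputable def invariantField (Q : Type*) [Field Q] [Algebra k Q] [Algebra Q B]
    [IsScalarTower k Q B] (ρ : B →ₐ[k] B ⊗[k] K) : IntermediateField k Q :=
  (invariantsIn Q ρ).toIntermediateField fun q hq => by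
    rcases eq_or_ne q 0 with rfl | h0
    · simp
    rw [mem_invariantsIn] at hq ⊢
    have hu : IsUnit (algebraMap Q B q ⊗ₜ[k] (1 : K)) :=
      (IsUnit.mk0 q h0).map (algebraMap Q (B ⊗[k] K))
    refine hu.mul_left_cancel ?_
    rw [← hq, ← map_mul, hq, Algebra.TensorProduct.tmul_mul_tmul, ← map_mul, mul_inv_cancel₀ h0,
      map_one, map_one, mul_one, Algebra.TensorProduct.one_def]

theorem mem_invariantField {ρ : B →ₐ[k] B ⊗[k] K} {q : Q} :
    q ∈ invariantField Q ρ ↔ ρ (algebraMap Q B q) = algebraMap Q B q ⊗ₜ 1 := Iff.rfl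

theorem aeval_mulRight {E : Type*} [Ring E] [Algebra Q E] (w : E) (p : Q[X]) :
    aeval (LinearMap.mulRight Q w) p = LinearMap.mulRight Q (aeval w p) := by
  induction p using Polynomial.induction_on' with
  | add p q hp hq =>
    rw [map_add, map_add, hp, hq]
    ext x
    simp [mul_add]
  | monomial n c =>
    rw [aeval_monomial, aeval_monomial, LinearMap.pow_mulRight]
    ext x
    simp [Algebra.algebraMap_eq_smul_one]

end InvariantField

section Denominators

open Polynomial

variable {k Z Q A B K : Type*} [Field k] [CommRing Z] [IsDomain Z] [Algebra k Z] [Field Q]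
  [Algebra Z Q] [IsFractionRing Z Q] [Algebra k Q] [IsScalarTower k Z Q] [Ring A] [Algebra k A]
  [Algebra Z A] [IsScalarTower k Z A] [Ring B] [Algebra k B] [Algebra Q B] [IsScalarTower k Q B]
  [FiniteDimensional Q B] [Ring K] [HopfAlgebra k K] [FiniteDimensional k K]

/-- The element `q` is an eigenvalue of right multiplication by `ρ q`. -/
theorem charpoly_eval_eq_zero_of_isRightCoaction [Nontrivial B] {ρ : B →ₐ[k] B ⊗[k] K}
    (hρ : IsRightCoaction ρ) (q : Q) :
    (LinearMap.mulRight Q (ρ (algebraMap Q B q))).charpoly.eval q = 0 := by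
  let ε : B ⊗[k] K →ₐ[k] B := (Algebra.TensorProduct.rid k k B).toAlgHom.comp
    (Algebra.TensorProduct.map (AlgHom.id k B) (Bialgebra.counitAlgHom k K))
  have hε1 : ε (ρ (algebraMap Q B q)) = algebraMap Q B q := hρ.counit _
  have hε2 : ε (algebraMap Q B q ⊗ₜ 1) = algebraMap Q B q := by simp [ε]
  rw [LinearMap.eval_charpoly]
  by_contra h
  -- the counit annihilates the image of `q - ρ q`, so that this element has no left inverse
  have hu : IsUnit (algebraMap Q (Module.End Q (B ⊗[k] K)) q -
      LinearMap.mulRight Q (ρ (algebraMap Q B q))) :=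
    (LinearMap.isUnit_iff_isUnit_det _).2 (IsUnit.mk0 _ h)
  obtain ⟨x, hx⟩ := ((Module.End.isUnit_iff _).1 hu).2 1
  have hx' : x * (algebraMap Q B q ⊗ₜ 1 - ρ (algebraMap Q B q)) = 1 := by
    rw [mul_sub, ← hx]
    simp only [LinearMap.sub_apply, LinearMap.mulRight_apply, Module.algebraMap_end_apply,
      Algebra.smul_def]
    rw [Algebra.commutes]
    rfl
  have := congrArg ε hx'
  rw [map_mul, map_sub, hε1, hε2, sub_self, mul_zero, map_one] at this
  exact zero_ne_one this

theorem exists_det_pow_mem_invariantField [Algebra.IsCentral Q B] [IsSimpleRing B]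
    {ρ : B →ₐ[k] B ⊗[k] K} (hρ : IsRightCoaction ρ) (b : B) :
    ∃ t : ℕ, (LinearMap.mulRight Q (ρ b)).det ^ (t + 1) ∈ invariantField Q ρ := by
  have hinv : ∀ f : invariantField Q ρ, ρ (algebraMap (invariantField Q ρ) B f) =
      algebraMap (invariantField Q ρ) B f ⊗ₜ 1 := fun f => by
    rw [IsScalarTower.algebraMap_apply (invariantField Q ρ) Q B]
    exact mem_invariantField.1 f.2
  have hfix : ∀ q : Q, ρ (algebraMap Q B q) = algebraMap Q B q ⊗ₜ 1 →
      ∃ f : invariantField Q ρ, algebraMap (invariantField Q ρ) Q f = q :=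
    fun q hq => ⟨⟨q, hq⟩, rfl⟩
  obtain ⟨t, ht, hdet⟩ := exists_det_pow_eq_algebraMap hρ hinv hfix
  obtain ⟨c, hc⟩ := hdet b
  obtain ⟨t, rfl⟩ := Nat.exists_eq_succ_of_ne_zero ht.ne'
  refine ⟨t, ?_⟩
  rw [← hc]
  exact c.2

omit [Algebra k Z] [IsScalarTower k Z Q] in
/-- Every nonzero element of `Z` has a nonzero invariant multiple, namely a power of the determinant
of right multiplication by `ρ z`. -/
theorem exists_dvd_mem_invariantField [Algebra.IsCentral Q B] [IsSimpleRing B]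
    {ρ : B →ₐ[k] B ⊗[k] K} (hρ : IsRightCoaction ρ)
    (hχ : ∀ z : Z, ∃ χ : Z[X], χ.map (algebraMap Z Q) =
      (LinearMap.mulRight Q (ρ (algebraMap Q B (algebraMap Z Q z)))).charpoly)
    (z : Z) (hz : z ≠ 0) :
    ∃ y : Z, z * y ≠ 0 ∧ algebraMap Z Q (z * y) ∈ invariantField Q ρ := by
  obtain ⟨χ, hχ⟩ := hχ z
  set f := LinearMap.mulRight Q (ρ (algebraMap Q B (algebraMap Z Q z))) with hf
  have h1 : χ.eval z = 0 := by
    refine IsFractionRing.injective Z Q ?_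
    rw [← eval_map_apply, hχ, map_zero]
    exact charpoly_eval_eq_zero_of_isRightCoaction hρ _
  have h2 : z ∣ χ.coeff 0 := by
    have := sub_dvd_eval_sub z 0 χ
    rwa [h1, zero_sub, sub_zero, dvd_neg, ← coeff_zero_eq_eval_zero] at this
  obtain ⟨y, hy⟩ := h2
  have h3 : f.det = (-1) ^ Module.finrank Q (B ⊗[k] K) * algebraMap Z Q (z * y) := by
    rw [LinearMap.det_eq_sign_charpoly_coeff, ← hχ, coeff_map, hy]
  have h4 : f.det ≠ 0 := by
    have hu : IsUnit (ρ (algebraMap Q B (algebraMap Z Q z))) :=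
      ((IsUnit.mk0 (algebraMap Z Q z) (by simpa using hz)).map (algebraMap Q B)).map ρ
    have : IsUnit f := by
      rw [Module.End.isUnit_iff]
      obtain ⟨u, hu⟩ := hu
      rw [hf, ← hu]
      exact (Units.mulRight_bijective u)
    exact ((LinearMap.isUnit_iff_isUnit_det f).1 this).ne_zero
  obtain ⟨t, h6⟩ := exists_det_pow_mem_invariantField (Q := Q) hρ
    (algebraMap Q B (algebraMap Z Q z))
  have h5 : algebraMap Z Q (z * y) ^ (t + 1) ∈ invariantField Q ρ := by
    have h7 : algebraMap Z Q (z * y) = (-1) ^ Module.finrank Q (B ⊗[k] K) * f.det := by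
      rw [h3, ← mul_assoc, ← mul_pow]; simp
    rw [h7, mul_pow]
    exact mul_mem (pow_mem (pow_mem (neg_mem (one_mem _)) _) _) h6
  refine ⟨y * (z * y) ^ t, ?_, ?_⟩
  · rw [← mul_assoc, ← pow_succ']
    refine pow_ne_zero _ fun h => h4 ?_
    rw [h3, h, map_zero, mul_zero]
  · rwa [← mul_assoc, ← pow_succ', map_pow]

omit [IsDomain Z] [IsFractionRing Z Q] [IsScalarTower k Z Q] [FiniteDimensional Q B]
  [FiniteDimensional k K] in
theorem mem_invariantsIn_iff_of_extendsCoaction {ι : A →ₐ[k] B}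
    (hι : Function.Injective ι)
    (hιZ : ∀ z, ι (algebraMap Z A z) = algebraMap Q B (algebraMap Z Q z))
    {ρ : A →ₐ[k] A ⊗[k] K} {ρB : B →ₐ[k] B ⊗[k] K} (hB : ExtendsCoaction ι ρ ρB) (z : Z) :
    algebraMap Z Q z ∈ invariantField Q ρB ↔ z ∈ invariantsIn Z ρ := by
  have hmapinj : Function.Injective (Algebra.TensorProduct.map ι (AlgHom.id k K)) :=
    Module.Flat.rTensor_preserves_injective_linearMap (M := K) ι.toLinearMap hι
  rw [mem_invariantField, mem_invariantsIn, ← hmapinj.eq_iff, ← hιZ, hB]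
  simp

omit [IsScalarTower k Z Q] [FiniteDimensional Q B] [FiniteDimensional k K] in
/-- The field of invariants in `Q` is the field of fractions of the ring of invariants in `Z`. -/
theorem exists_div_of_mem_invariantField {ι : A →ₐ[k] B}
    (hι : Function.Injective ι)
    (hιZ : ∀ z, ι (algebraMap Z A z) = algebraMap Q B (algebraMap Z Q z))
    {ρ : A →ₐ[k] A ⊗[k] K} {ρB : B →ₐ[k] B ⊗[k] K} (hB : ExtendsCoaction ι ρ ρB)
    (hinv : ∀ z : Z, z ≠ 0 → ∃ y : Z, z * y ≠ 0 ∧ algebraMap Z Q (z * y) ∈ invariantField Q ρB)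
    {q : Q} (hq : q ∈ invariantField Q ρB) :
    ∃ a b : invariantsIn Z ρ, q = algebraMap Z Q a / algebraMap Z Q b := by
  obtain ⟨w, y, hy, rfl⟩ := IsFractionRing.div_surjective (A := Z) q
  obtain ⟨v, hv0, hv⟩ := hinv y (nonZeroDivisors.ne_zero hy)
  have h0 : algebraMap Z Q y ≠ 0 := by simpa using nonZeroDivisors.ne_zero hy
  have h1 : algebraMap Z Q v ≠ 0 := by simpa using right_ne_zero_of_mul hv0
  have h2 : algebraMap Z Q w / algebraMap Z Q y =
      algebraMap Z Q (w * v) / algebraMap Z Q (y * v) := by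
    rw [map_mul, map_mul, mul_div_mul_right _ _ h1]
  have h3 : algebraMap Z Q (w * v) ∈ invariantField Q ρB := by
    have h4 : algebraMap Z Q (w * v) =
        algebraMap Z Q w / algebraMap Z Q y * algebraMap Z Q (y * v) := by
      rw [map_mul, map_mul]; field_simp
    rw [h4]
    exact mul_mem hq hv
  exact ⟨⟨w * v, (mem_invariantsIn_iff_of_extendsCoaction hι hιZ hB _).1 h3⟩,
    ⟨y * v, (mem_invariantsIn_iff_of_extendsCoaction hι hιZ hB _).1 hv⟩, h2⟩

end Denominators

/-! ### Integrality of the characteristic polynomial -/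

section Integrality

open Polynomial

variable {k Z Q A B K : Type*} [Field k] [CommRing Z] [IsDomain Z] [Algebra k Z] [Field Q]
  [Algebra Z Q] [IsFractionRing Z Q] [Algebra k Q] [IsScalarTower k Z Q] [Ring A] [Algebra k A]
  [Algebra Z A] [IsScalarTower k Z A] [Ring B] [Algebra k B] [Algebra Q B] [IsScalarTower k Q B]
  [FiniteDimensional Q B] [Ring K] [Algebra k K] [FiniteDimensional k K]

omit [IsScalarTower k Z Q] in
/-- Elements of the finite `Z`-algebra `A ⊗ K` are integral over `Z`. -/
theorem exists_map_eq_charpoly_mulRight_of_isIntegrallyClosed [Module.Finite Z A]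
    [IsIntegrallyClosed Z] {ι : A →ₐ[k] B}
    (hιZ : ∀ z, ι (algebraMap Z A z) = algebraMap Q B (algebraMap Z Q z)) (x : A ⊗[k] K) :
    ∃ χ : Z[X], χ.map (algebraMap Z Q) =
      (LinearMap.mulRight Q (Algebra.TensorProduct.map ι (AlgHom.id k K) x)).charpoly := by
  have hfin : Module.Finite Z (A ⊗[k] K) := inferInstance
  obtain ⟨p, hm, hp⟩ := IsIntegral.of_finite Z x
  refine exists_map_eq_charpoly_of_isIntegrallyClosed _ p hm ?_
  rw [aeval_mulRight]
  have h1 : aeval (Algebra.TensorProduct.map ι (AlgHom.id k K) x) (p.map (algebraMap Z Q)) = 0 := by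
    have h2 := hom_eval₂ p (algebraMap Z (A ⊗[k] K))
      (Algebra.TensorProduct.map ι (AlgHom.id k K)).toRingHom x
    rw [hp, map_zero] at h2
    rw [aeval_def, eval₂_map, h2]
    refine congrArg (fun g => eval₂ g _ p) (RingHom.ext fun z => ?_)
    change algebraMap Q B (algebraMap Z Q z) ⊗ₜ[k] (1 : K) =
      Algebra.TensorProduct.map ι (AlgHom.id k K) (algebraMap Z A z ⊗ₜ 1)
    simp [hιZ]
  rw [h1]
  ext
  simp

omit [IsDomain Z] [IsFractionRing Z Q] in
/-- The `Z`-module `A ⊗ K` is finite and projective, with base change `(Q ⊗ A) ⊗ K`. -/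
theorem exists_map_eq_charpoly_mulRight_of_projective [Module.Finite Z A]
    [Module.Projective Z A] [IsScalarTower k Q (Q ⊗[Z] A)] {ι : A →ₐ[k] Q ⊗[Z] A}
    (hι : ∀ a, ι a = 1 ⊗ₜ a) (x : A ⊗[k] K) :
    ∃ χ : Z[X], χ.map (algebraMap Z Q) =
      (LinearMap.mulRight Q (Algebra.TensorProduct.map ι (AlgHom.id k K) x)).charpoly := by
  have hfin : Module.Finite Z (A ⊗[k] K) := inferInstance
  have hproj : Module.Projective Z (A ⊗[k] K) := inferInstance
  let e := Algebra.TensorProduct.assoc k Z Q Q A K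
  have hx : e (Algebra.TensorProduct.map ι (AlgHom.id k K) x) = 1 ⊗ₜ x := by
    induction x with
    | zero => simp
    | add x y hx hy => simp only [map_add, hx, hy, TensorProduct.tmul_add]
    | tmul a c => simp [e, hι]
  obtain ⟨χ, hχ⟩ := exists_map_eq_charpoly_of_projective (Q := Q) (LinearMap.mulRight Z x)
  refine ⟨χ, hχ.trans ?_⟩
  rw [← LinearEquiv.charpoly_conj e.toLinearEquiv]
  refine congrArg _ (LinearMap.ext fun y => ?_)
  have h1 : e.toLinearEquiv.conj (LinearMap.mulRight Q
      (Algebra.TensorProduct.map ι (AlgHom.id k K) x)) y = y * 1 ⊗ₜ x := by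
    change e (e.symm y * _) = _
    rw [map_mul, hx, e.apply_symm_apply]
  rw [h1]
  clear h1
  induction y with
  | zero => simp
  | add y z hy hz => rw [map_add, hy, hz, add_mul]
  | tmul q w => simp

end Integrality

section Fraction

open Polynomial

variable {k Z Q A : Type*} [Field k] [CommRing Z] [IsDomain Z] [Algebra k Z] [Field Q]
  [Algebra Z Q] [IsFractionRing Z Q] [Algebra k Q] [IsScalarTower k Z Q] [Ring A] [Algebra k A]
  [Algebra Z A] [IsScalarTower k Z A]

theorem includeRight_injective_of_isTorsionFree [Module.IsTorsionFree Z A] :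
    Function.Injective (TensorProduct.mk Z Q A 1) := by
  intro a b h
  obtain ⟨c, hc⟩ := (IsLocalizedModule.eq_iff_exists (nonZeroDivisors Z)
    (TensorProduct.mk Z Q A 1)).1 h
  exact smul_right_injective _ (nonZeroDivisors.ne_zero c.2) hc

theorem exists_algebraMap_mul_eq_tmul (b : Q ⊗[Z] A) :
    ∃ z : Z, z ≠ 0 ∧ ∃ a : A, (1 ⊗ₜ algebraMap Z A z) * b = 1 ⊗ₜ a := by
  obtain ⟨⟨a, z⟩, h⟩ := IsLocalizedModule.surj (nonZeroDivisors Z) (TensorProduct.mk Z Q A 1) b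
  refine ⟨z, nonZeroDivisors.ne_zero z.2, a, ?_⟩
  rw [← TensorProduct.mk_apply, ← TensorProduct.mk_apply, ← h, Algebra.algebraMap_eq_smul_one,
    map_smul, smul_mul_assoc]
  rw [TensorProduct.mk_apply, ← Algebra.TensorProduct.one_def, one_mul]
  rfl

end Fraction

/-! ### The degree of the field of invariants -/

section Degree

open Polynomial

/-- The divisibility, for an arbitrary model `B` of the central localization of `A`. The hypothesis
`hχ` is the integrality of characteristic polynomials. -/
theorem finrank_dvd_of_localization {k Z Q A B K QK : Type*} [Field k]
    [Ring K] [HopfAlgebra k K] [FiniteDimensional k K] [Ring A] [Algebra k A]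
    [CommRing Z] [IsDomain Z] [Algebra k Z] [Algebra Z A] [IsScalarTower k Z A]
    [Field Q] [Algebra Z Q] [IsFractionRing Z Q] [Algebra k Q] [IsScalarTower k Z Q]
    [Ring B] [Algebra k B] [Algebra Q B] [IsScalarTower k Q B] [FiniteDimensional Q B]
    [Algebra.IsCentral Q B] [IsSimpleRing B] {ρ : A →ₐ[k] A ⊗[k] K} (hρ : IsRightCoaction ρ)
    [Field QK] [Algebra (invariantsIn Z ρ) QK] [IsFractionRing (invariantsIn Z ρ) QK]
    [Algebra QK Q] [IsScalarTower (invariantsIn Z ρ) QK Q]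
    [Algebra k QK] [IsScalarTower k QK Q] [Algebra QK B] [IsScalarTower QK Q B]
    [IsScalarTower k QK B] (ι : A →ₐ[k] B) (hι : Function.Injective ι)
    (hιZ : ∀ z, ι (algebraMap Z A z) = algebraMap Q B (algebraMap Z Q z))
    (hloc : ∀ b : B, ∃ z : Z, z ≠ 0 ∧ ∃ a, ι (algebraMap Z A z) * b = ι a)
    (hχ : ∀ x : A ⊗[k] K, ∃ χ : Z[X], χ.map (algebraMap Z Q) =
      (LinearMap.mulRight Q (Algebra.TensorProduct.map ι (AlgHom.id k K) x)).charpoly) :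
    FiniteDimensional QK Q ∧ Module.finrank QK Q ∣ Module.finrank k K := by
  obtain ⟨ρB, hB⟩ : ∃ ρB : B →ₐ[k] B ⊗[k] K, ExtendsCoaction ι ρ ρB :=
    exists_extension_of_isUnit (Q := Q) ι hι hιZ hloc
      ((Algebra.TensorProduct.map ι (AlgHom.id k K)).comp ρ)
      fun z hz => isUnit_map_coaction hι hιZ hloc hρ z hz
  have hρB := hB.isRightCoaction hιZ hloc hρ
  have hmult : ∀ z : Z, z ≠ 0 →
      ∃ y : Z, z * y ≠ 0 ∧ algebraMap Z Q (z * y) ∈ invariantField Q ρB := by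
    refine exists_dvd_mem_invariantField hρB fun z => ?_
    rw [← hιZ, hB]
    exact hχ _
  have hZ := mem_invariantsIn_iff_of_extendsCoaction (Q := Q) hι hιZ hB
  have hQK : ∀ a : invariantsIn Z ρ,
      algebraMap QK Q (algebraMap (invariantsIn Z ρ) QK a) = algebraMap Z Q a := fun a =>
    (IsScalarTower.algebraMap_apply (invariantsIn Z ρ) QK Q a).symm
  refine finrank_dvd_of_coaction hρB (fun f => ?_) fun q hq => ?_
  · obtain ⟨a, b, -, rfl⟩ := IsFractionRing.div_surjective (A := invariantsIn Z ρ) f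
    have h : algebraMap QK Q (algebraMap (invariantsIn Z ρ) QK a /
        algebraMap (invariantsIn Z ρ) QK b) ∈ invariantField Q ρB := by
      rw [map_div₀, hQK, hQK]
      exact div_mem ((hZ a).2 a.2) ((hZ b).2 b.2)
    rw [IsScalarTower.algebraMap_apply QK Q B]
    exact mem_invariantField.1 h
  · obtain ⟨a, b, rfl⟩ := exists_div_of_mem_invariantField hι hιZ hB hmult (mem_invariantField.2 hq)
    exact ⟨algebraMap _ QK a / algebraMap _ QK b, by rw [map_div₀, hQK, hQK]⟩

end Degree

theorem mainTheorem5 {k K A Z Q QK : Type*}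
    [Field k] [IsAlgClosed k]
    -- a finite dimensional Hopf algebra and a right comodule algebra over it
    [Ring K] [HopfAlgebra k K] [FiniteDimensional k K]
    [Ring A] [Algebra k A]
    (ρ : A →ₐ[k] A ⊗[k] K) (hρ : IsRightCoaction ρ)
    -- a central subalgebra which is a domain
    [CommRing Z] [IsDomain Z] [Algebra k Z] [Algebra Z A] [IsScalarTower k Z A]
    (hZA : Function.Injective (algebraMap Z A))
    -- its field of fractions
    [Field Q] [Algebra Z Q] [IsFractionRing Z Q]
    -- the field of fractions of the central invariants, inside `Q`
    [Field QK] [Algebra (invariantsIn Z ρ) QK] [IsFractionRing (invariantsIn Z ρ) QK]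
    [Algebra QK Q] [IsScalarTower (invariantsIn Z ρ) QK Q]
    (h1 : Module.Finite Z A)
    (h2 : Algebra.IsCentral Q (Q ⊗[Z] A) ∧ IsSimpleRing (Q ⊗[Z] A))
    (h345 : (Module.IsTorsionFree Z A ∧ IsIntegrallyClosed Z) ∨ Module.Projective Z A) :
    FiniteDimensional QK Q ∧ Module.finrank QK Q ∣ Module.finrank k K := by
  obtain ⟨hcentral, hsimple⟩ := h2
  have htf : Module.IsTorsionFree Z A := h345.elim (fun h => h.1) fun h => inferInstance
  -- the `k`-algebra structures on `Q` and `QK` are those induced by `Z` and its invariants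
  let algQ : Algebra k Q := ((algebraMap Z Q).comp (algebraMap k Z)).toAlgebra
  have : IsScalarTower k Z Q := IsScalarTower.of_algebraMap_eq fun _ => rfl
  let algQK : Algebra k QK := ((algebraMap (invariantsIn Z ρ) QK).comp
    (algebraMap k (invariantsIn Z ρ))).toAlgebra
  have : IsScalarTower k QK Q := IsScalarTower.of_algebraMap_eq fun c => by
    change algebraMap Z Q (algebraMap k Z c) =
      algebraMap QK Q (algebraMap (invariantsIn Z ρ) QK (algebraMap k (invariantsIn Z ρ) c))
    rw [← IsScalarTower.algebraMap_apply (invariantsIn Z ρ) QK Q]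
    rfl
  have : IsScalarTower QK Q (Q ⊗[Z] A) := inferInstance
  have : IsScalarTower k Q (Q ⊗[Z] A) := inferInstance
  have : IsScalarTower k QK (Q ⊗[Z] A) := IsScalarTower.of_algebraMap_eq fun c => by
    rw [IsScalarTower.algebraMap_apply QK Q (Q ⊗[Z] A), ← IsScalarTower.algebraMap_apply k QK Q,
      ← IsScalarTower.algebraMap_apply k Q (Q ⊗[Z] A)]
  let ι : A →ₐ[k] Q ⊗[Z] A :=
    (Algebra.TensorProduct.includeRight : A →ₐ[Z] Q ⊗[Z] A).restrictScalars k
  have hι : ∀ a, ι a = 1 ⊗ₜ a := fun _ => rfl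
  have hιZ : ∀ z, ι (algebraMap Z A z) = algebraMap Q (Q ⊗[Z] A) (algebraMap Z Q z) := fun z => by
    rw [hι, Algebra.TensorProduct.algebraMap_apply, Algebra.algebraMap_eq_smul_one,
      Algebra.algebraMap_eq_smul_one, TensorProduct.tmul_smul, ← TensorProduct.smul_tmul',
      algebraMap_smul]
  refine finrank_dvd_of_localization hρ ι includeRight_injective_of_isTorsionFree hιZ
    exists_algebraMap_mul_eq_tmul fun x => ?_
  rcases h345 with ⟨-, h⟩ | h
  · exact exists_map_eq_charpoly_mulRight_of_isIntegrallyClosed hιZ x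
  · exact exists_map_eq_charpoly_mulRight_of_projective hι x
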